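/- **Theorem 2 (Limits of walk-distance weighted counts).** Let $\mathcal G$ be a connected simple undirected graph on a finite node set $\mathcal V$ with $n\ge 2$ nodes and nonnegative weighted adjacency matrix $A$ ($\{i,j\}$ is an edge iff $A_{ij}>0$), let $W=D^{-1}A$, $D=\mathrm{diag}(d_i)$, $d_i=\sum_j A_{ij}$, be the transition matrix of the natural random walk, and let $\boldsymbol\pi$ be its stationary distribution. Let $\{\alpha_v\}_{v\ge1}$ be real numbers with $\sum_{v=1}^\infty|\alpha_v|<\infty$ and let $k\ge 0$ be an integer. For $m\in\mathcal V$ and $p\ge 1$ let $(X^{(m,p)}_s)_{s\ge1}$ be mutually independent Markov chains with transition matrix $W$ and $X^{(m,p)}_1=m$ a.s. For given $r,\ell\ge1$ the algorithm uses the first $\ell$ positions of the walks with $p\le r$. For each $m$, $p\le r$, $v\ge 1$, $1\le s\le \ell-v$ and $1\le c\le k$ it draws a node $Z^{(m,p,s,v)}_c$ such that, conditionally on these $rn$ walks of length $\ell$, all the $Z$'s of this execution are i.i.d. with the empirical distribution $\widehat q(j)=\frac{1}{nr\ell}\sum_{m}\sum_{p\le r}\sum_{s\le\ell}\mathbf 1\{X^{(m,p)}_s=j\}$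 (the joint law of the $Z$'s of executions with different $(r,\ell)$ is arbitrary). Put $$n_{ij}^+=\sum_{v=1}^\infty\alpha_v\sum_{m\in\mathcal V}\sum_{p=1}^r\sum_{s=1}^{\ell-v}\mathbf 1\{X^{(m,p)}_s=i,\;X^{(m,p)}_{s+v}=j\},\qquad n_{ij}^-=\sum_{v=1}^\infty\alpha_v\sum_{m\in\mathcal V}\sum_{p=1}^r\sum_{s=1}^{\ell-v}\sum_{c=1}^k\mathbf 1\{X^{(m,p)}_s=i,\;Z^{(m,p,s,v)}_c=j\},$$ where a sum whose upper limit is smaller than its lower limit is $0$. Then almost surely, for all nodes $i,j$, all the following limits exist and have the stated values. 1. For every fixed $r\ge1$, $$\frac1{rn}\lim_{\ell\to\infty}\frac{n_{ij}^+}{\ell}=\pi_i\sum_{v=1}^\infty\alpha_v(W^v)_{ij},\qquad \frac1{rn}\lim_{\ell\to\infty}\frac{n_{ij}^-}{\ell}=k\pi_i\pi_j\sum_{v=1}^\infty\alpha_v.$$ 2. For every fixed $\ell\ge1$, $$\frac1{\ell n}\lim_{r\to\infty}\frac{n_{ij}^+}{r}=\frac1{\ell n}\sum_{m\in\mathcal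 V}\sum_{v=1}^\infty\alpha_v(W^v)_{ij}\sum_{s=1}^{\ell-v}(W^{s-1})_{mi},\qquad \frac1{\ell n}\lim_{r\to\infty}\frac{n_{ij}^-}{r}=\frac{k\pi^{(\ell)}_j}{\ell n}\sum_{m\in\mathcal V}\sum_{v=1}^\infty\alpha_v\sum_{s=1}^{\ell-v}(W^{s-1})_{mi},$$ where $\pi^{(\ell)}_j=\frac1\ell\sum_{u=1}^\ell\frac1n\sum_{m\in\mathcal V}(W^{u-1})_{mj}$. 3. $$\frac1n\lim_{r\to\infty}\lim_{\ell\to\infty}\frac{n_{ij}^+}{r\ell}=\frac1n\lim_{\ell\to\infty}\lim_{r\to\infty}\frac{n_{ij}^+}{r\ell}=\pi_i\sum_{v=1}^\infty\alpha_v(W^v)_{ij},$$ $$\frac1n\lim_{r\to\infty}\lim_{\ell\to\infty}\frac{n_{ij}^-}{r\ell}=\frac1n\lim_{\ell\to\infty}\lim_{r\to\infty}\frac{n_{ij}^-}{r\ell}=k\pi_i\pi_j\sum_{v=1}^\infty\alpha_v.$$ Moreover, without any aperiodicity assumption, for every probability vector $\boldsymbol\mu$ on $\mathcal V$ the Cesàro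 averages $\frac1\ell\sum_{s=1}^\ell\boldsymbol\mu^\top W^s$ converge to $\boldsymbol\pi^\top$ as $\ell\to\infty$, and $\pi^{(\ell)}_j\to\pi_j$ for every node $j$. -/

import Mathlib

open MeasureTheory ProbabilityTheory Filter Topology Finset

noncomputable section

namespace VEC

/-- A simple undirected graph on the node set `V` with nonnegative edge weights, given by its
weighted adjacency matrix; `{i, j}` is an edge exactly when its weight is positive. -/
structure WeightedGraph (V : Type*) where
  /-- the weighted adjacency matrix -/
  weight : Matrix V V ℝ
  symm : weight.IsSymm
  nonneg : ∀ i j, 0 ≤ weight i j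
  loopless : ∀ i, weight i i = 0

namespace WeightedGraph

variable {V : Type*}

/-- The underlying simple graph. -/
def toSimpleGraph (G : WeightedGraph V) : SimpleGraph V where
  Adj i j := 0 < G.weight i j
  symm := ⟨fun i j (h : 0 < G.weight i j) => by
    have := G.symm.apply i j
    show 0 < G.weight j i
    rwa [this]⟩
  loopless := ⟨fun i (h : 0 < G.weight i i) => by
    rw [G.loopless i] at h
    exact lt_irrefl _ h⟩

/-- The (weighted) degree of a node. -/
def degree [Fintype V] (G : WeightedGraph V) (i : V) : ℝ := ∑ j, G.weight i j

/-- The transition matrix `D⁻¹ A` of the natural random walk. -/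
def transition [Fintype V] (G : WeightedGraph V) : Matrix V V ℝ :=
  Matrix.of fun i j => G.weight i j / G.degree i

end WeightedGraph

/-- `π` is a probability vector with `π W = π`. -/
def IsStationary {V : Type*} [Fintype V] (W : Matrix V V ℝ) (π : V → ℝ) : Prop :=
  π ∈ stdSimplex ℝ V ∧ Matrix.vecMul π W = π

/-- The process `Y 0, Y 1, …` is a Markov chain started at the state `m` with transition
matrix `W`: its finite-dimensional laws are the products of transition probabilities. -/
def IsMarkovChainFrom {V Ω : Type*} [DecidableEq V] [MeasurableSpace Ω]
    (P : Measure Ω) (W : Matrix V V ℝ) (m : V) (Y : ℕ → Ω → V) : Prop :=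
  ∀ (T : ℕ) (x : ℕ → V),
    P.real {ω | ∀ s ≤ T, Y s ω = x s} =
      (if x 0 = m then 1 else 0) * ∏ s ∈ range T, W (x s) (x (s + 1))

/-- Empirical unigram frequency of the node `j` in the first `ℓ` positions of the first `r`
walks from every node. Walks and positions are numbered from `0`: `x m p s` is the node at the
`(s+1)`-st position of the `(p+1)`-st walk that starts from node `m`. -/
def unigram {V : Type*} [Fintype V] [DecidableEq V] (r ℓ : ℕ) (x : V → ℕ → ℕ → V) (j : V) : ℝ :=
  (∑ m, ∑ p ∈ range r, ∑ s ∈ range ℓ, if x m p s = j then (1 : ℝ) else 0) /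
    (Fintype.card V * r * ℓ)

/-- The labels `(m, p, s, v, c)` of the negative samples that the algorithm draws: one for every
position pair `(s, s + v)`, `v ≥ 1`, inside the first `ℓ` positions of one of the `r` walks
from `m`, and every `c < k`. -/
def negSlots (V : Type*) [Fintype V] (r ℓ k : ℕ) : Finset (V × ℕ × ℕ × ℕ × ℕ) :=
  ((univ : Finset V) ×ˢ range r ×ˢ range ℓ ×ˢ range ℓ ×ˢ range k).filter
    fun q => 1 ≤ q.2.2.2.1 ∧ q.2.2.1 + q.2.2.2.1 < ℓ

/-- The random objects of the algorithm, for all numbers `r` of walks per node and all walk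
lengths `ℓ`. `X m p s` are the walks. `Z r ℓ (m, p, s, v, c)` is the second node of the
`(c+1)`-st negative pair attached to the positive pair `(X m p s, X m p (s + v))` in the
execution with parameters `r`, `ℓ`. -/
structure IsSampling {V Ω : Type*} [Fintype V] [DecidableEq V] [MeasurableSpace V]
    [MeasurableSpace Ω] (P : Measure Ω) (W : Matrix V V ℝ) (k : ℕ)
    (X : V → ℕ → ℕ → Ω → V) (Z : ℕ → ℕ → V × ℕ × ℕ × ℕ × ℕ → Ω → V) : Prop where
  measurable_walk : ∀ m p s, Measurable (X m p s)
  measurable_neg : ∀ r ℓ q, Measurable (Z r ℓ q)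
  /-- each walk from `m` is a Markov chain with transition matrix `W` -/
  markov : ∀ m p, IsMarkovChainFrom P W m (X m p)
  /-- the walks are mutually independent -/
  indep : iIndepFun (fun (a : V × ℕ) (ω : Ω) (s : ℕ) => X a.1 a.2 s ω) P
  /-- conditionally on the `r` walks of length `ℓ` from every node, the negative samples of the
  execution with parameters `r`, `ℓ` are i.i.d. with the empirical unigram distribution -/
  neg_law : ∀ (r ℓ : ℕ) (x : V → ℕ → ℕ → V) (z : V × ℕ × ℕ × ℕ × ℕ → V),
    P.real {ω | (∀ m, ∀ p < r, ∀ s < ℓ, X m p s ω = x m p s) ∧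
        ∀ q ∈ negSlots V r ℓ k, Z r ℓ q ω = z q} =
      P.real {ω | ∀ m, ∀ p < r, ∀ s < ℓ, X m p s ω = x m p s} *
        ∏ q ∈ negSlots V r ℓ k, unigram r ℓ x (z q)

section Counts

variable {V : Type*} [Fintype V] [DecidableEq V]

/-- Number of occurrences of `i` followed by `j` exactly `v` steps later in the first `ℓ`
positions of the first `r` walks from every node. -/
def posCountAt (x : V → ℕ → ℕ → V) (i j : V) (r ℓ v : ℕ) : ℝ :=
  ∑ m, ∑ p ∈ range r, ∑ s ∈ range (ℓ - v),
    if x m p s = i ∧ x m p (s + v) = j then (1 : ℝ) else 0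

/-- Number of negative pairs `(i, j)` attached to positive pairs at distance exactly `v`. -/
def negCountAt (k : ℕ) (x : V → ℕ → ℕ → V) (z : V × ℕ × ℕ × ℕ × ℕ → V) (i j : V)
    (r ℓ v : ℕ) : ℝ :=
  ∑ m, ∑ p ∈ range r, ∑ s ∈ range (ℓ - v), ∑ c ∈ range k,
    if x m p s = i ∧ z (m, p, s, v, c) = j then (1 : ℝ) else 0

/-- The walk-distance weighted positive-pair count (all terms with `v ≥ ℓ` vanish). -/
def posCount (α : ℕ+ → ℝ) (x : V → ℕ → ℕ → V) (i j : V) (r ℓ : ℕ) : ℝ :=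
  ∑' v : ℕ+, α v * posCountAt x i j r ℓ v

/-- The walk-distance weighted negative-pair count (all terms with `v ≥ ℓ` vanish). -/
def negCount (α : ℕ+ → ℝ) (k : ℕ) (x : V → ℕ → ℕ → V) (z : V × ℕ × ℕ × ℕ × ℕ → V)
    (i j : V) (r ℓ : ℕ) : ℝ :=
  ∑' v : ℕ+, α v * negCountAt k x z i j r ℓ v

/-- The positive large-length limit: `π_i ∑_{v ≥ 1} α_v (W^v)_{ij}`. -/
def posLimit (W : Matrix V V ℝ) (π : V → ℝ) (α : ℕ+ → ℝ) (i j : V) : ℝ :=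
  π i * ∑' v : ℕ+, α v * (W ^ (v : ℕ)) i j

/-- The negative large-length limit: `k π_i π_j ∑_{v ≥ 1} α_v`. -/
def negLimit (π : V → ℝ) (α : ℕ+ → ℝ) (k : ℕ) (i j : V) : ℝ :=
  k * π i * π j * ∑' v : ℕ+, α v

/-- Expected unigram distribution of walks of length `ℓ` with a uniformly chosen start:
`(1/ℓ) ∑_{u=1}^{ℓ} (1/n) 1ᵀ W^{u-1} e_j`. -/
def cesaroUnigram (W : Matrix V V ℝ) (ℓ : ℕ) (j : V) : ℝ :=
  (1 / (ℓ : ℝ)) * ∑ u ∈ range ℓ, (1 / (Fintype.card V : ℝ)) * ∑ m, (W ^ u) m j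

/-- The positive limit for length `ℓ` and many walks:
`(1/(ℓn)) ∑_m ∑_{v ≥ 1} α_v (W^v)_{ij} ∑_{s=1}^{ℓ-v} (W^{s-1})_{mi}`, the inner sum being `0`
when `v ≥ ℓ`. -/
def posLimitLen (W : Matrix V V ℝ) (α : ℕ+ → ℝ) (i j : V) (ℓ : ℕ) : ℝ :=
  1 / (ℓ * Fintype.card V) *
    ∑ m, ∑' v : ℕ+, α v * (W ^ (v : ℕ)) i j * ∑ s ∈ range (ℓ - v), (W ^ s) m i

/-- The negative limit for length `ℓ` and many walks:
`(k π^{(ℓ)}_j/(ℓn)) ∑_m ∑_{v ≥ 1} α_v ∑_{s=1}^{ℓ-v} (W^{s-1})_{mi}`, the inner sum being `0`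
when `v ≥ ℓ`. -/
def negLimitLen (W : Matrix V V ℝ) (α : ℕ+ → ℝ) (k : ℕ) (i j : V) (ℓ : ℕ) : ℝ :=
  k * cesaroUnigram W ℓ j / (ℓ * Fintype.card V) *
    ∑ m, ∑' v : ℕ+, α v * ∑ s ∈ range (ℓ - v), (W ^ s) m i

/-- The positive count `n_{ij}^+` at the outcome `ω`. -/
def nPos {Ω : Type*} (α : ℕ+ → ℝ) (X : V → ℕ → ℕ → Ω → V) (i j : V) (r ℓ : ℕ) (ω : Ω) : ℝ :=
  posCount α (fun m p s => X m p s ω) i j r ℓ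

/-- The negative count `n_{ij}^-` at the outcome `ω`. -/
def nNeg {Ω : Type*} (α : ℕ+ → ℝ) (k : ℕ) (X : V → ℕ → ℕ → Ω → V)
    (Z : ℕ → ℕ → V × ℕ × ℕ × ℕ × ℕ → Ω → V) (i j : V) (r ℓ : ℕ) (ω : Ω) : ℝ :=
  negCount α k (fun m p s => X m p s ω) (fun q => Z r ℓ q ω) i j r ℓ

end Counts

/-- `lim_{a → ∞} lim_{b → ∞} f a b = L`, where the inner limit exists for every `a ≥ 1`. -/
def HasIteratedLimit (f : ℕ → ℕ → ℝ) (L : ℝ) : Prop :=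
  ∃ g : ℕ → ℝ, (∀ a, 1 ≤ a → Tendsto (f a) atTop (𝓝 (g a))) ∧ Tendsto g atTop (𝓝 L)

end VEC

end

/-!
The argument has three ingredients.

*Stationarity.* On a connected graph a stationary vector divided by the degrees is harmonic, so by
the maximum principle it is constant; hence the stationary distribution is unique
(`WeightedGraph.stationary_unique`). By compactness of the simplex, probability vectors `q n` with
`q n W - q n → 0` converge to it (`tendsto_of_asymptotically_invariant`). This gives the Cesàro
convergence of the powers of `W` without aperiodicity, and, applied to the empirical distribution
of a walk, it also replaces the ergodic theorem.

*Walks.* Given the path up to time `s`, the variable `1{Y s = i} (1{Y (s + v) = j} - (W ^ v) i j)`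
is centred, so these variables are uncorrelated at lags at least `v`. A strong law for bounded
variables that are uncorrelated at large lags (`ae_tendsto_avg_zero`) makes their averages vanish
almost surely. For `v = 1` this shows that the empirical distribution of the walk is asymptotically
invariant, hence tends to `π`; for general `v` it then gives the pair frequency `π i (W ^ v) i j`.
The same law, over independent walks, handles the limit of many walks.

*Negative samples.* Nothing is known about the joint law of the samples of different executions, so
each execution is controlled separately. Conditionally on the walks, the deviation of the negative
count from its conditional mean is a sum of independent centred variables; its exponential moments
factorize and give a fourth moment of the order of the square of the number of slots
(`IsSampling.integral_negDeviation_pow_four`). Hence the fourth moments of the normalized deviations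
are summable, and these tend to zero almost surely in either limit.

All outcomes with these properties are typical (`IsTypical`), and for them the limits are
deterministic: the counts at each walk distance converge, and dominated convergence with the bound
`|α v|` sums them over the distances.
-/

namespace VEC

/-! ### Stationary distributions of the natural random walk -/

section Stationary

variable {V : Type*} [Fintype V]

namespace WeightedGraph

lemma degree_pos [Nontrivial V] (G : WeightedGraph V) (hG : G.toSimpleGraph.Connected) (i : V) :
    0 < G.degree i := by
  classical
  obtain ⟨j, hj⟩ := hG.preconnected.exists_adj_of_nontrivial i
  exact sum_pos' (fun j _ => G.nonneg i j) ⟨j, mem_univ j, hj⟩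

lemma transition_mem_rowStochastic [DecidableEq V] [Nontrivial V] (G : WeightedGraph V)
    (hG : G.toSimpleGraph.Connected) : G.transition ∈ Matrix.rowStochastic ℝ V := by
  rw [Matrix.mem_rowStochastic_iff_sum]
  refine ⟨fun i j => div_nonneg (G.nonneg i j) (G.degree_pos hG i).le, fun i => ?_⟩
  simp only [transition, Matrix.of_apply, ← sum_div]
  exact div_self (G.degree_pos hG i).ne'

/-- Maximum principle: on a connected graph a function whose value at each node is the weighted
average of its values at the neighbours is constant. -/
lemma eq_of_harmonic (G : WeightedGraph V) (hG : G.toSimpleGraph.Connected) {h : V → ℝ}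
    (hh : ∀ j, ∑ i, G.weight j i * h i = G.degree j * h j) (a b : V) : h a = h b := by
  have : Nonempty V := ⟨a⟩
  obtain ⟨m, hm⟩ := Finite.exists_max h
  have step : ∀ i j, G.toSimpleGraph.Adj i j → h i = h m → h j = h m := by
    intro i j hij hi
    have h0 : ∑ l, G.weight i l * (h m - h l) = 0 := by
      simp only [mul_sub, sum_sub_distrib, ← sum_mul]
      rw [hh i, hi, degree, sub_self]
    have h1 := (sum_eq_zero_iff_of_nonneg
      (fun l _ => mul_nonneg (G.nonneg i l) (sub_nonneg.2 (hm l)))).1 h0 j (mem_univ j)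
    have h2 : 0 < G.weight i j := hij
    rcases mul_eq_zero.1 h1 with h3 | h3 <;> linarith
  have all : ∀ c, h c = h m := by
    intro c
    obtain ⟨w⟩ := hG.preconnected m c
    have key : ∀ {u v : V}, G.toSimpleGraph.Walk u v → h u = h m → h v = h m := by
      intro u v w
      induction w with
      | nil => exact id
      | cons hadj _ ih => exact fun hu => ih (step _ _ hadj hu)
    exact key w rfl
  rw [all a, all b]

/-- The ratio of a stationary distribution to the degrees is harmonic, hence constant. -/
lemma stationary_unique [Nontrivial V] (G : WeightedGraph V) (hG : G.toSimpleGraph.Connected)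
    {π ν : V → ℝ} (hπ : IsStationary G.transition π) (hν : IsStationary G.transition ν) :
    ν = π := by
  have hd := G.degree_pos hG
  have key : ∀ {ρ : V → ℝ}, IsStationary G.transition ρ →
      ∃ c : ℝ, c * ∑ i, G.degree i = 1 ∧ ∀ i, ρ i = c * G.degree i := by
    intro ρ hρ
    have harm : ∀ j, ∑ i, G.weight j i * (ρ i / G.degree i) = G.degree j * (ρ j / G.degree j) := by
      intro j
      rw [mul_div_cancel₀ _ (hd j).ne']
      have := congrFun hρ.2 j
      simp only [Matrix.vecMul, dotProduct, transition, Matrix.of_apply] at this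
      rw [← this]
      refine sum_congr rfl fun i _ => ?_
      rw [← G.symm.apply i j]
      ring
    obtain ⟨a⟩ := hG.nonempty
    have heq : ∀ i, ρ i = ρ a / G.degree a * G.degree i := fun i => by
      rw [← G.eq_of_harmonic hG harm i a, div_mul_cancel₀ _ (hd i).ne']
    refine ⟨ρ a / G.degree a, ?_, heq⟩
    rw [mul_sum, ← hρ.1.2]
    exact sum_congr rfl fun i _ => (heq i).symm
  obtain ⟨c, hc, hc'⟩ := key hπ
  obtain ⟨e, he, he'⟩ := key hν
  have hne : ∑ i, G.degree i ≠ 0 := fun h => by simp [h] at hc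
  have : e = c := mul_right_cancel₀ hne (he.trans hc.symm)
  ext i
  rw [hc', he', this]

end WeightedGraph

/-- Asymptotically invariant probability vectors converge to the stationary distribution when
that is unique: by compactness it suffices that every cluster point is stationary. -/
lemma tendsto_of_asymptotically_invariant {W : Matrix V V ℝ} {π : V → ℝ}
    (huniq : ∀ ν, IsStationary W ν → ν = π) {q : ℕ → V → ℝ}
    (hq : ∀ᶠ n in atTop, q n ∈ stdSimplex ℝ V)
    (hinv : ∀ j, Tendsto (fun n => Matrix.vecMul (q n) W j - q n j) atTop (𝓝 0)) :
    Tendsto q atTop (𝓝 π) := by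
  refine (isCompact_stdSimplex ℝ V).tendsto_nhds_of_unique_mapClusterPt hq fun y hy hc => ?_
  refine huniq y ⟨hy, ?_⟩
  obtain ⟨φ, hφ, hlim⟩ := hc.tendsto_subseq
  ext j
  have hcont : Continuous fun ν : V → ℝ => Matrix.vecMul ν W j - ν j := by
    simp only [Matrix.vecMul, dotProduct]
    fun_prop
  have h1 := (hcont.tendsto y).comp hlim
  have h2 := (hinv j).comp hφ.tendsto_atTop
  exact sub_eq_zero.1 (tendsto_nhds_unique h1 h2)

lemma abs_le_one_of_mem_stdSimplex {μ : V → ℝ} (hμ : μ ∈ stdSimplex ℝ V) (j : V) : |μ j| ≤ 1 := by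
  rw [abs_of_nonneg (hμ.1 j), ← hμ.2]
  exact single_le_sum (fun i _ => hμ.1 i) (mem_univ j)

lemma avg_mem_stdSimplex {a : ℕ → V → ℝ} (ha : ∀ s, a s ∈ stdSimplex ℝ V) {n : ℕ} (hn : n ≠ 0) :
    (fun j => (∑ s ∈ range n, a s j) / n) ∈ stdSimplex ℝ V := by
  refine ⟨fun j => div_nonneg (sum_nonneg fun s _ => (ha s).1 j) n.cast_nonneg, ?_⟩
  rw [← sum_div, sum_comm, sum_congr rfl fun s _ => (ha s).2]
  simp [hn]

end Stationary

/-! ### Averages of bounded sequences -/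

/-- Dropping a bounded number of final terms does not affect the limit of the averages. -/
lemma tendsto_avg_sub {a : ℕ → ℝ} {C L : ℝ} (ha : ∀ s, |a s| ≤ C) (v : ℕ)
    (h : Tendsto (fun n : ℕ => (∑ s ∈ range n, a s) / n) atTop (𝓝 L)) :
    Tendsto (fun n : ℕ => (∑ s ∈ range (n - v), a s) / n) atTop (𝓝 L) := by
  have h0 : Tendsto (fun n : ℕ => v * C / (n : ℝ)) atTop (𝓝 0) :=
    tendsto_const_div_atTop_nhds_zero_nat _
  refine tendsto_of_tendsto_of_dist h (squeeze_zero (fun _ => dist_nonneg) (fun n => ?_) h0)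
  have hsub : range (n - v) ⊆ range n := range_mono (Nat.sub_le _ _)
  rw [Real.dist_eq, ← sub_div, ← sum_sdiff hsub, add_sub_cancel_right, abs_div, Nat.abs_cast]
  gcongr
  calc |∑ s ∈ range n \ range (n - v), a s| ≤ ∑ s ∈ range n \ range (n - v), |a s| :=
        abs_sum_le_sum_abs _ _
    _ ≤ ∑ s ∈ range n \ range (n - v), C := sum_le_sum fun s _ => ha s
    _ = (n - (n - v) : ℕ) * C := by
        rw [sum_const, card_sdiff_of_subset hsub, card_range, card_range, nsmul_eq_mul]
    _ ≤ v * C := by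
        have : 0 ≤ C := (abs_nonneg _).trans (ha 0)
        gcongr
        omega

/-- The averages of a bounded sequence and of its shift have the same limits. -/
lemma tendsto_avg_shift_sub {a : ℕ → ℝ} {C : ℝ} (ha : ∀ s, |a s| ≤ C) :
    Tendsto (fun n : ℕ => (∑ s ∈ range n, a (s + 1)) / n - (∑ s ∈ range n, a s) / n)
      atTop (𝓝 0) := by
  have h0 : Tendsto (fun n : ℕ => (C + C) / (n : ℝ)) atTop (𝓝 0) :=
    tendsto_const_div_atTop_nhds_zero_nat _
  refine squeeze_zero_norm (fun n => ?_) h0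
  rw [← sub_div, ← sum_sub_distrib, sum_range_sub, Real.norm_eq_abs, abs_div, Nat.abs_cast]
  gcongr
  exact (abs_sub _ _).trans (add_le_add (ha _) (ha _))

/-- Dominated convergence for the `α`-weighted sum over walk distances. -/
lemma tendsto_weighted_tsum {α : ℕ+ → ℝ} (hα : Summable fun v => |α v|) {C : ℝ}
    {c : ℕ → ℕ+ → ℝ} {L : ℕ+ → ℝ} (hc : ∀ n v, |c n v| ≤ C)
    (h : ∀ v, Tendsto (fun n => c n v) atTop (𝓝 (L v))) :
    Tendsto (fun n => ∑' v, α v * c n v) atTop (𝓝 (∑' v, α v * L v)) := by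
  refine tendsto_tsum_of_dominated_convergence (bound := fun v => |α v| * C) (hα.mul_right C)
    (fun v => (h v).const_mul _) (Eventually.of_forall fun n v => ?_)
  rw [Real.norm_eq_abs, abs_mul]
  gcongr
  exact hc n v

/-! ### Cesàro convergence of the powers of the transition matrix -/

section Cesaro

variable {V : Type*} [Fintype V] [DecidableEq V] {W : Matrix V V ℝ} {π : V → ℝ}

lemma vecMul_mem_stdSimplex (hW : W ∈ Matrix.rowStochastic ℝ V) {μ : V → ℝ}
    (hμ : μ ∈ stdSimplex ℝ V) : Matrix.vecMul μ W ∈ stdSimplex ℝ V := by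
  refine ⟨Matrix.nonneg_vecMul_of_mem_rowStochastic hW hμ.1, ?_⟩
  have h1 : μ ⬝ᵥ 1 = 1 := by simpa [dotProduct] using hμ.2
  simpa [dotProduct] using Matrix.vecMul_dotProduct_one_eq_one_rowStochastic hW h1

lemma tendsto_avg_vecMul_pow (hW : W ∈ Matrix.rowStochastic ℝ V)
    (huniq : ∀ ν, IsStationary W ν → ν = π) {μ : V → ℝ} (hμ : μ ∈ stdSimplex ℝ V) (j : V) :
    Tendsto (fun n : ℕ => (∑ s ∈ range n, Matrix.vecMul μ (W ^ s) j) / n) atTop (𝓝 (π j)) := by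
  have hmem : ∀ s, Matrix.vecMul μ (W ^ s) ∈ stdSimplex ℝ V := fun s =>
    vecMul_mem_stdSimplex (pow_mem hW s) hμ
  refine tendsto_pi_nhds.1 (tendsto_of_asymptotically_invariant
    (q := fun n j => (∑ s ∈ range n, Matrix.vecMul μ (W ^ s) j) / n) huniq
    (eventually_atTop.2 ⟨1, fun n hn => avg_mem_stdSimplex hmem (by omega)⟩) fun j => ?_) j
  refine (tendsto_avg_shift_sub (a := fun s => Matrix.vecMul μ (W ^ s) j)
    (fun s => abs_le_one_of_mem_stdSimplex (hmem s) j)).congr fun n => ?_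
  congr 1
  simp only [pow_succ, ← Matrix.vecMul_vecMul]
  simp only [Matrix.vecMul, dotProduct, div_mul_eq_mul_div, ← sum_div, sum_mul]
  rw [sum_comm]

lemma tendsto_avg_pow (hW : W ∈ Matrix.rowStochastic ℝ V)
    (huniq : ∀ ν, IsStationary W ν → ν = π) (m j : V) :
    Tendsto (fun n : ℕ => (∑ s ∈ range n, (W ^ s) m j) / n) atTop (𝓝 (π j)) := by
  simpa using tendsto_avg_vecMul_pow hW huniq (single_mem_stdSimplex ℝ m) j

lemma abs_pow_apply_le_one (hW : W ∈ Matrix.rowStochastic ℝ V) (s : ℕ) (i j : V) :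
    |(W ^ s) i j| ≤ 1 := by
  rw [abs_of_nonneg (Matrix.nonneg_of_mem_rowStochastic (pow_mem hW s))]
  exact Matrix.le_one_of_mem_rowStochastic (pow_mem hW s)

lemma tendsto_cesaroUnigram [Nonempty V] (hW : W ∈ Matrix.rowStochastic ℝ V)
    (huniq : ∀ ν, IsStationary W ν → ν = π) (j : V) :
    Tendsto (fun ℓ : ℕ => cesaroUnigram W ℓ j) atTop (𝓝 (π j)) := by
  have hn : (Fintype.card V : ℝ) ≠ 0 := by simp
  have h := (tendsto_finsetSum univ fun m _ => tendsto_avg_pow hW huniq m j).const_mul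
    (1 / (Fintype.card V : ℝ))
  have hlim : 1 / (Fintype.card V : ℝ) * ∑ _m : V, π j = π j := by
    rw [sum_const, card_univ, nsmul_eq_mul]
    field_simp
  rw [hlim] at h
  refine h.congr fun ℓ => ?_
  simp only [cesaroUnigram, ← mul_sum, ← sum_div]
  rw [sum_comm]
  ring

end Cesaro

/-! ### Almost sure convergence from moment bounds -/

section Moments

variable {Ω : Type*} [MeasurableSpace Ω] {P : Measure Ω}

lemma integrable_of_abs_le [IsFiniteMeasure P] {f : Ω → ℝ} (hf : Measurable f) {C : ℝ}
    (h : ∀ ω, |f ω| ≤ C) : Integrable f P :=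
  Integrable.of_bound hf.aestronglyMeasurable C (Eventually.of_forall h)

/-- Nonnegative random variables with summable expectations tend to zero almost surely. -/
lemma ae_tendsto_zero_of_summable_integral {f : ℕ → Ω → ℝ} (hf : ∀ n, Integrable (f n) P)
    (h0 : ∀ n ω, 0 ≤ f n ω) (hs : Summable fun n => ∫ ω, f n ω ∂P) :
    ∀ᵐ ω ∂P, Tendsto (fun n => f n ω) atTop (𝓝 0) := by
  have hmeas : ∀ n, AEMeasurable (fun ω => ENNReal.ofReal (f n ω)) P := fun n =>
    (hf n).aestronglyMeasurable.aemeasurable.ennreal_ofReal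
  have hfin : ∫⁻ ω, ∑' n, ENNReal.ofReal (f n ω) ∂P ≠ ⊤ := by
    rw [lintegral_tsum hmeas]
    have : ∀ n, ∫⁻ ω, ENNReal.ofReal (f n ω) ∂P = ENNReal.ofReal (∫ ω, f n ω ∂P) := fun n =>
      (ofReal_integral_eq_lintegral_ofReal (hf n) (Eventually.of_forall (h0 n))).symm
    simp_rw [this]
    exact hs.tsum_ofReal_ne_top
  filter_upwards [ae_lt_top' (AEMeasurable.tsum hmeas) hfin] with ω hω
  have h1 := ENNReal.tendsto_cofinite_zero_of_tsum_ne_top hω.ne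
  rw [Nat.cofinite_eq_atTop] at h1
  have h2 := (ENNReal.tendsto_toReal ENNReal.zero_ne_top).comp h1
  simpa [Function.comp_def, ENNReal.toReal_ofReal (h0 _ ω)] using h2

/-- Second moment of a sum of bounded variables that are uncorrelated at lag `v` and beyond. -/
lemma integral_sum_sq_le [IsProbabilityMeasure P] {ξ : ℕ → Ω → ℝ} (hm : ∀ s, Measurable (ξ s))
    {C : ℝ} (hC : ∀ s ω, |ξ s ω| ≤ C) {v : ℕ}
    (horth : ∀ s t, s + v ≤ t → ∫ ω, ξ s ω * ξ t ω ∂P = 0) (n : ℕ) :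
    ∫ ω, (∑ s ∈ range n, ξ s ω) ^ 2 ∂P ≤ n * (2 * v * C ^ 2) := by
  have hC' : ∀ s t ω, |ξ s ω * ξ t ω| ≤ C ^ 2 := fun s t ω => by
    rw [abs_mul, sq]
    exact mul_le_mul (hC s ω) (hC t ω) (abs_nonneg _) ((abs_nonneg _).trans (hC s ω))
  have hint : ∀ s t, Integrable (fun ω => ξ s ω * ξ t ω) P := fun s t =>
    integrable_of_abs_le ((hm s).mul (hm t)) (hC' s t)
  have hle : ∀ s t, ∫ ω, ξ s ω * ξ t ω ∂P ≤ C ^ 2 := fun s t => by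
    have := integral_mono (hint s t) (integrable_const (μ := P) (C ^ 2))
      fun ω => (le_abs_self _).trans (hC' s t ω)
    simpa using this
  have hexp : ∫ ω, (∑ s ∈ range n, ξ s ω) ^ 2 ∂P
      = ∑ s ∈ range n, ∑ t ∈ range n, ∫ ω, ξ s ω * ξ t ω ∂P := by
    simp_rw [sq, sum_mul_sum]
    rw [integral_finsetSum _ fun s _ => integrable_finsetSum _ fun t _ => hint s t]
    exact sum_congr rfl fun s _ => integral_finsetSum _ fun t _ => hint s t
  rw [hexp]
  have hrow : ∀ s, ∑ t ∈ range n, ∫ ω, ξ s ω * ξ t ω ∂P ≤ 2 * v * C ^ 2 := by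
    intro s
    -- only the indices `t` with `s - v < t < s + v` contribute
    have hterm : ∀ t ∈ range n, ∫ ω, ξ s ω * ξ t ω ∂P
        ≤ if t ∈ Ico (s - v) (s + v) then C ^ 2 else 0 := by
      intro t _
      split_ifs with h
      · exact hle s t
      · rw [mem_Ico, not_and_or] at h
        rcases h with h | h
        · rw [integral_congr_ae (Eventually.of_forall fun ω => mul_comm (ξ s ω) (ξ t ω))]
          exact (horth t s (by omega)).le
        · exact (horth s t (by omega)).le
    refine (sum_le_sum hterm).trans ?_
    rw [← sum_filter, sum_const, nsmul_eq_mul]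
    have hcard : ((range n).filter (· ∈ Ico (s - v) (s + v))).card ≤ 2 * v := by
      refine (card_le_card (t := Ico (s - v) (s + v)) fun t ht => (mem_filter.1 ht).2).trans ?_
      rw [Nat.card_Ico]
      omega
    have : (((range n).filter (· ∈ Ico (s - v) (s + v))).card : ℝ) ≤ 2 * v := by
      exact_mod_cast hcard
    gcongr
  calc _ ≤ ∑ s ∈ range n, 2 * v * C ^ 2 := sum_le_sum fun s _ => hrow s
    _ = _ := by rw [sum_const, card_range, nsmul_eq_mul]

/-- The averages of a bounded sequence converge to `0` as soon as they do so along the squares. -/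
lemma tendsto_avg_of_tendsto_sq {a : ℕ → ℝ} {C : ℝ} (ha : ∀ s, |a s| ≤ C)
    (h : Tendsto (fun n : ℕ => (∑ s ∈ range ((n + 1) ^ 2), a s) / ((n : ℝ) + 1) ^ 2)
      atTop (𝓝 0)) :
    Tendsto (fun n : ℕ => (∑ s ∈ range n, a s) / n) atTop (𝓝 0) := by
  have hC : 0 ≤ C := (abs_nonneg _).trans (ha 0)
  have hsqrt : Tendsto (fun m : ℕ => Nat.sqrt m - 1) atTop atTop := by
    refine tendsto_atTop.2 fun b => eventually_atTop.2 ⟨(b + 1) ^ 2, fun m hm => ?_⟩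
    have := Nat.le_sqrt'.2 hm
    omega
  have hbound : Tendsto (fun n : ℕ => |(∑ s ∈ range ((n + 1) ^ 2), a s) / ((n : ℝ) + 1) ^ 2|
      + 2 * C * (1 / ((n : ℝ) + 1))) atTop (𝓝 0) := by
    simpa using h.abs.add (tendsto_one_div_add_atTop_nhds_zero_nat.const_mul (2 * C))
  refine squeeze_zero_norm' (eventually_atTop.2 ⟨1, fun m hm => ?_⟩) (hbound.comp hsqrt)
  obtain ⟨n, hn⟩ : ∃ n, Nat.sqrt m = n + 1 :=
    Nat.exists_eq_succ_of_ne_zero (Nat.sqrt_pos.2 hm).ne'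
  have hlow : (n + 1) ^ 2 ≤ m := hn ▸ Nat.sqrt_le' m
  have hup : m < (n + 2) ^ 2 := by
    have := Nat.lt_succ_sqrt' m
    rwa [hn] at this
  have hlow' : ((n : ℝ) + 1) ^ 2 ≤ m := by exact_mod_cast hlow
  simp only [Function.comp_apply, hn, Nat.add_sub_cancel]
  have hsub : range ((n + 1) ^ 2) ⊆ range m := range_mono hlow
  have hrest : |∑ s ∈ range m \ range ((n + 1) ^ 2), a s| ≤ 2 * C * ((n : ℝ) + 1) := by
    calc _ ≤ ∑ s ∈ range m \ range ((n + 1) ^ 2), |a s| := abs_sum_le_sum_abs _ _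
      _ ≤ ∑ s ∈ range m \ range ((n + 1) ^ 2), C := sum_le_sum fun s _ => ha s
      _ = (m - (n + 1) ^ 2 : ℕ) * C := by
        rw [sum_const, card_sdiff_of_subset hsub, card_range, card_range, nsmul_eq_mul]
      _ ≤ (2 * ((n : ℝ) + 1)) * C := by
        gcongr
        have : m - (n + 1) ^ 2 ≤ 2 * (n + 1) := by
          have : (n + 2) ^ 2 = (n + 1) ^ 2 + 2 * (n + 1) + 1 := by ring
          omega
        exact_mod_cast this
      _ = _ := by ring
  have hpos : (0 : ℝ) < ((n : ℝ) + 1) ^ 2 := by positivity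
  rw [← sum_sdiff hsub, Real.norm_eq_abs, abs_div, Nat.abs_cast, abs_div,
    abs_of_pos hpos, add_comm (∑ s ∈ range m \ range ((n + 1) ^ 2), a s)]
  calc _ ≤ (|∑ s ∈ range ((n + 1) ^ 2), a s| + 2 * C * ((n : ℝ) + 1)) / ((n : ℝ) + 1) ^ 2 := by
        gcongr
        exact (abs_add_le _ _).trans (by gcongr)
    _ = _ := by field_simp

/-- Strong law of large numbers for bounded variables that are uncorrelated at lag `v` and
beyond. -/
lemma ae_tendsto_avg_zero [IsProbabilityMeasure P] {ξ : ℕ → Ω → ℝ} (hm : ∀ s, Measurable (ξ s))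
    {C : ℝ} (hC : ∀ s ω, |ξ s ω| ≤ C) {v : ℕ}
    (horth : ∀ s t, s + v ≤ t → ∫ ω, ξ s ω * ξ t ω ∂P = 0) :
    ∀ᵐ ω ∂P, Tendsto (fun n : ℕ => (∑ s ∈ range n, ξ s ω) / n) atTop (𝓝 0) := by
  have hsum : ∀ n ω, |∑ s ∈ range n, ξ s ω| ≤ n * C := fun n ω => by
    refine (abs_sum_le_sum_abs _ _).trans ((sum_le_sum fun s _ => hC s ω).trans ?_)
    simp
  let f : ℕ → Ω → ℝ := fun n ω => ((∑ s ∈ range ((n + 1) ^ 2), ξ s ω) / ((n : ℝ) + 1) ^ 2) ^ 2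
  have hSm : ∀ n, Measurable fun ω => ∑ s ∈ range n, ξ s ω := fun n =>
    Finset.measurable_sum _ fun s _ => hm s
  have hfi : ∀ n, Integrable (f n) P := fun n => by
    refine integrable_of_abs_le (C := C ^ 2) (((hSm _).div_const _).pow_const 2) fun ω => ?_
    have hp : (0 : ℝ) < ((n : ℝ) + 1) ^ 2 := by positivity
    rw [abs_pow, abs_div, abs_of_pos hp]
    gcongr
    rw [div_le_iff₀ hp, mul_comm]
    exact_mod_cast hsum ((n + 1) ^ 2) ω
  have hbd : ∀ n, ∫ ω, f n ω ∂P ≤ 2 * v * C ^ 2 * (1 / ((n : ℝ) + 1) ^ 2) := fun n => by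
    have h1 := integral_sum_sq_le hm hC horth ((n + 1) ^ 2)
    have hp : (0 : ℝ) < ((n : ℝ) + 1) ^ 2 := by positivity
    simp only [f, div_pow]
    rw [integral_div, div_le_iff₀ (by positivity)]
    refine h1.trans (le_of_eq ?_)
    push_cast
    field_simp
  have hs : Summable fun n => ∫ ω, f n ω ∂P := by
    refine Summable.of_nonneg_of_le (fun n => integral_nonneg fun ω => sq_nonneg _) hbd ?_
    refine Summable.mul_left _ ?_
    have := (summable_nat_add_iff 1).2 (Real.summable_one_div_nat_pow.2 one_lt_two)
    simpa using this
  filter_upwards [ae_tendsto_zero_of_summable_integral hfi (fun n ω => sq_nonneg _) hs] with ω hω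
  refine tendsto_avg_of_tendsto_sq (fun s => hC s ω) ?_
  have h2 := hω.sqrt
  simp only [f, Real.sqrt_sq_eq_abs, Real.sqrt_zero] at h2
  exact (tendsto_zero_iff_abs_tendsto_zero _).2 h2

end Moments

/-! ### Time averages along a finite Markov chain -/

section Deviations

variable {V : Type*} [Fintype V] [DecidableEq V] {W : Matrix V V ℝ}

/-- The deviation, at time `s`, of the indicator of the pair `(i, j)` at distance `v` from its
conditional expectation given the path up to time `s`. -/
def pairDeviation (W : Matrix V V ℝ) (v : ℕ) (i j : V) (y : ℕ → V) (s : ℕ) : ℝ :=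
  (if y s = i then 1 else 0) * ((if y (s + v) = j then 1 else 0) - (W ^ v) i j)

lemma abs_pairDeviation_le (hW : W ∈ Matrix.rowStochastic ℝ V) (v : ℕ) (i j : V) (y : ℕ → V)
    (s : ℕ) : |pairDeviation W v i j y s| ≤ 1 := by
  have h0 : 0 ≤ (W ^ v) i j := Matrix.nonneg_of_mem_rowStochastic (pow_mem hW v)
  have h1 : (W ^ v) i j ≤ 1 := Matrix.le_one_of_mem_rowStochastic (pow_mem hW v)
  rw [pairDeviation, abs_le]
  split_ifs <;> constructor <;> linarith

/-- Visit frequencies converge to the stationary distribution: by the one-step deviations the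
empirical distribution is asymptotically invariant. -/
lemma tendsto_avg_visits {π : V → ℝ} (huniq : ∀ ν, IsStationary W ν → ν = π) {y : ℕ → V}
    (hy : ∀ i j, Tendsto (fun n : ℕ => (∑ s ∈ range n, pairDeviation W 1 i j y s) / n)
      atTop (𝓝 0)) (j : V) :
    Tendsto (fun n : ℕ => (∑ s ∈ range n, if y s = j then (1 : ℝ) else 0) / n)
      atTop (𝓝 (π j)) := by
  have hmem : ∀ s, (fun j => if y s = j then (1 : ℝ) else 0) ∈ stdSimplex ℝ V := fun s =>
    ⟨fun j => by dsimp only; split_ifs <;> norm_num, by simp⟩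
  refine tendsto_pi_nhds.1 (tendsto_of_asymptotically_invariant
    (q := fun n j => (∑ s ∈ range n, if y s = j then (1 : ℝ) else 0) / n) huniq
    (eventually_atTop.2 ⟨1, fun n hn => avg_mem_stdSimplex hmem (by omega)⟩) fun j => ?_) j
  have h1 := tendsto_finsetSum univ fun i _ => hy i j
  have h2 := tendsto_avg_shift_sub (a := fun s => if y s = j then (1 : ℝ) else 0)
    (fun s => abs_le_one_of_mem_stdSimplex (hmem s) j)
  have h3 := h2.sub h1
  rw [sum_const_zero, sub_zero] at h3
  refine h3.congr fun n => ?_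
  have hdev : ∑ i, (∑ s ∈ range n, pairDeviation W 1 i j y s) / (n : ℝ)
      = (∑ s ∈ range n, if y (s + 1) = j then (1 : ℝ) else 0) / n
        - Matrix.vecMul (fun i => (∑ s ∈ range n, if y s = i then (1 : ℝ) else 0) / n) W j := by
    simp only [Matrix.vecMul, dotProduct, div_mul_eq_mul_div, ← sum_div, sum_mul]
    rw [← sub_div, sum_comm, sum_comm (s := univ), ← sum_sub_distrib]
    congr 1
    refine sum_congr rfl fun s _ => ?_
    simp [pairDeviation]
  rw [hdev]
  ring

lemma tendsto_avg_pairs {π : V → ℝ} (huniq : ∀ ν, IsStationary W ν → ν = π) {y : ℕ → V}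
    (hy : ∀ v i j, Tendsto (fun n : ℕ => (∑ s ∈ range n, pairDeviation W v i j y s) / n)
      atTop (𝓝 0)) (v : ℕ) (i j : V) :
    Tendsto (fun n : ℕ => (∑ s ∈ range n, if y s = i ∧ y (s + v) = j then (1 : ℝ) else 0) / n)
      atTop (𝓝 (π i * (W ^ v) i j)) := by
  have h := (hy v i j).add ((tendsto_avg_visits huniq (hy 1) i).mul_const ((W ^ v) i j))
  rw [zero_add] at h
  refine h.congr fun n => ?_
  rw [div_mul_eq_mul_div, ← add_div, sum_mul, ← sum_add_distrib]
  congr 1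
  refine sum_congr rfl fun s _ => ?_
  rw [pairDeviation]
  by_cases h1 : y s = i <;> by_cases h2 : y (s + v) = j <;> simp [h1, h2]

end Deviations

section Measurability

variable {Ω V : Type*} [MeasurableSpace Ω] [MeasurableSpace V] [MeasurableSingletonClass V]

lemma measurableSet_path {Y : ℕ → Ω → V} (hY : ∀ s, Measurable (Y s)) (t : ℕ) (x : ℕ → V) :
    MeasurableSet {ω | ∀ s ≤ t, Y s ω = x s} := by
  have : {ω | ∀ s ≤ t, Y s ω = x s} = ⋂ s, ⋂ (_ : s ≤ t), Y s ⁻¹' {x s} := by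
    ext ω
    simp
  rw [this]
  exact .iInter fun s => .iInter fun _ => hY s (measurableSet_singleton _)

lemma measurable_indicator_eq [DecidableEq V] {g : Ω → V} (hg : Measurable g) (i : V) :
    Measurable fun ω => if g ω = i then (1 : ℝ) else 0 :=
  Measurable.ite (hg (measurableSet_singleton i)) measurable_const measurable_const

lemma measureReal_eq_sum_fibers {P : Measure Ω} [IsFiniteMeasure P] [Fintype V]
    {g : Ω → V} (hg : Measurable g) {E : Set Ω}
    (hE : MeasurableSet E) : P.real E = ∑ y, P.real (E ∩ {ω | g ω = y}) := by
  rw [← measureReal_biUnion_finset (f := fun y => E ∩ {ω | g ω = y})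
    (fun y _ z _ hyz => Set.disjoint_left.2 fun ω h1 h2 => hyz (h1.2.symm.trans h2.2))
    (fun y _ => hE.inter (hg (measurableSet_singleton y)))]
  congr 1
  ext ω
  simp

end Measurability

section Markov

variable {Ω : Type*} [MeasurableSpace Ω] {P : Measure Ω} [IsProbabilityMeasure P]

lemma integral_comp_fintype {β : Type*} [Fintype β] [MeasurableSpace β]
    [MeasurableSingletonClass β] {Φ : Ω → β} (hΦ : Measurable Φ) (H : β → ℝ) :
    ∫ ω, H (Φ ω) ∂P = ∑ b, P.real {ω | Φ ω = b} * H b := by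
  have : IsProbabilityMeasure (P.map Φ) := Measure.isProbabilityMeasure_map hΦ.aemeasurable
  rw [← integral_map (φ := Φ) (f := H) hΦ.aemeasurable
    (Measurable.of_discrete (f := H)).aestronglyMeasurable, integral_fintype .of_finite]
  refine sum_congr rfl fun b _ => ?_
  rw [map_measureReal_apply hΦ (measurableSet_singleton b), smul_eq_mul]
  rfl

variable {V : Type*} [Fintype V] [DecidableEq V] [MeasurableSpace V] [MeasurableSingletonClass V]
  {W : Matrix V V ℝ} {m : V} {Y : ℕ → Ω → V}

/-- The `v`-step Markov property, conditionally on the whole path up to time `t`. -/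
lemma IsMarkovChainFrom.path_and_later (hM : IsMarkovChainFrom P W m Y)
    (hY : ∀ s, Measurable (Y s)) (v t : ℕ) (x : ℕ → V) (j : V) :
    P.real {ω | (∀ s ≤ t, Y s ω = x s) ∧ Y (t + v) ω = j}
      = P.real {ω | ∀ s ≤ t, Y s ω = x s} * (W ^ v) (x t) j := by
  induction v generalizing t x with
  | zero =>
    rw [pow_zero, Matrix.one_apply]
    split_ifs with h
    · rw [mul_one]
      congr 1
      ext ω
      simp only [Set.mem_ofPred_eq, add_zero, and_iff_left_iff_imp]
      exact fun hω => (hω t le_rfl).trans h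
    · rw [mul_zero]
      convert measureReal_empty
      ext ω
      simp only [Set.mem_ofPred_eq, add_zero, Set.mem_empty_iff_false, iff_false, not_and]
      exact fun hω hj => h ((hω t le_rfl).symm.trans hj)
  | succ v ih =>
    have hE : MeasurableSet {ω | (∀ s ≤ t, Y s ω = x s) ∧ Y (t + (v + 1)) ω = j} :=
      (measurableSet_path hY t x).inter (hY _ (measurableSet_singleton j))
    rw [measureReal_eq_sum_fibers (hY (t + 1)) hE, pow_succ', Matrix.mul_apply, mul_sum]
    refine sum_congr rfl fun y _ => ?_
    have hext : ∀ ω, (∀ s ≤ t + 1, Y s ω = Function.update x (t + 1) y s)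
        ↔ (∀ s ≤ t, Y s ω = x s) ∧ Y (t + 1) ω = y := by
      intro ω
      constructor
      · intro h
        refine ⟨fun s hs => ?_, by simpa using h (t + 1) le_rfl⟩
        simpa [Function.update_of_ne (show s ≠ t + 1 by omega)] using h s (by omega)
      · rintro ⟨h1, h2⟩ s hs
        rcases eq_or_ne s (t + 1) with rfl | hne
        · simpa using h2
        · rw [Function.update_of_ne hne]
          exact h1 s (by omega)
    have hstep := hM (t + 1) (Function.update x (t + 1) y)
    rw [prod_range_succ, ← mul_assoc, Function.update_self,
      Function.update_of_ne (show t ≠ t + 1 by omega),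
      Function.update_of_ne (show 0 ≠ t + 1 by omega),
      prod_congr rfl (fun s hs => by
        have := mem_range.1 hs
        rw [Function.update_of_ne (show s ≠ t + 1 by omega),
          Function.update_of_ne (show s + 1 ≠ t + 1 by omega)] :
        ∀ s ∈ range t, W (Function.update x (t + 1) y s) (Function.update x (t + 1) y (s + 1))
          = W (x s) (x (s + 1))), ← hM t x] at hstep
    have h := ih (t + 1) (Function.update x (t + 1) y)
    rw [hstep, Function.update_self, mul_assoc] at h
    rw [← h]
    congr 1
    ext ω
    simp only [Set.mem_inter_iff, Set.mem_ofPred_eq, hext]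
    rw [show t + 1 + v = t + (v + 1) by ring]
    tauto

/-- A deviation is orthogonal to every function of the path up to its time. -/
lemma IsMarkovChainFrom.integral_mul_pairDeviation (hM : IsMarkovChainFrom P W m Y)
    (hW : W ∈ Matrix.rowStochastic ℝ V) (hY : ∀ s, Measurable (Y s)) (v t : ℕ) (i j : V)
    (F : (ℕ → V) → ℝ) (hF : ∀ x y : ℕ → V, (∀ s ≤ t, x s = y s) → F x = F y) :
    ∫ ω, F (fun s => Y s ω) * pairDeviation W v i j (fun s => Y s ω) t ∂P = 0 := by
  let ext : (Fin (t + 1) → V) → ℕ → V := fun a s => a ⟨min s t, by omega⟩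
  let Φ : Ω → (Fin (t + 1) → V) × V := fun ω => (fun s => Y s ω, Y (t + v) ω)
  have hΦ : Measurable Φ := 
    (measurable_pi_lambda (fun ω (s : Fin (t + 1)) => Y s ω) fun s => hY s).prodMk (hY (t + v))
  have hpath : ∀ ω a, (fun s : Fin (t + 1) => Y s ω) = a ↔ ∀ s ≤ t, Y s ω = ext a s := by
    intro ω a
    constructor
    · rintro rfl s hs
      simp [ext, hs]
    · intro h
      ext s
      have hs : (s : ℕ) ≤ t := by omega
      simpa [ext, hs] using h s hs
  let H : (Fin (t + 1) → V) × V → ℝ := fun b => F (ext b.1) *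
    ((if ext b.1 t = i then 1 else 0) * ((if b.2 = j then 1 else 0) - (W ^ v) i j))
  have hrw : ∀ ω, F (fun s => Y s ω) * pairDeviation W v i j (fun s => Y s ω) t = H (Φ ω) := by
    intro ω
    have h := (hpath ω _).1 rfl
    simp only [pairDeviation, Φ, H, ← h t le_rfl]
    rw [hF _ _ h]
  rw [integral_congr_ae (Eventually.of_forall hrw), integral_comp_fintype hΦ H,
    Fintype.sum_prod_type]
  refine sum_eq_zero fun a _ => ?_
  have hprob : ∀ y, P.real {ω | Φ ω = (a, y)}
      = P.real {ω | ∀ s ≤ t, Y s ω = ext a s} * (W ^ v) (ext a t) y := by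
    intro y
    rw [← hM.path_and_later hY v t (ext a) y]
    congr 1
    ext ω
    simp only [Φ, Set.mem_ofPred_eq, Prod.mk.injEq, hpath]
  simp only [hprob, H]
  by_cases hi : ext a t = i
  · have hsum : ∑ y, (W ^ v) i y * ((if y = j then 1 else 0) - (W ^ v) i j) = 0 := by
      simp only [mul_sub, sum_sub_distrib, ← sum_mul,
        Matrix.sum_row_of_mem_rowStochastic (pow_mem hW v)]
      simp
    simp only [hi, if_true, one_mul]
    calc _ = P.real {ω | ∀ s ≤ t, Y s ω = ext a s} * F (ext a)
          * ∑ y, (W ^ v) i y * ((if y = j then 1 else 0) - (W ^ v) i j) := by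
          rw [mul_sum]
          exact sum_congr rfl fun y _ => by ring
      _ = 0 := by rw [hsum, mul_zero]
  · simp [hi]

lemma measurable_pairDeviation (hY : ∀ s, Measurable (Y s)) (v : ℕ) (i j : V) (s : ℕ) :
    Measurable fun ω => pairDeviation W v i j (fun s => Y s ω) s :=
  (measurable_indicator_eq (hY _) i).mul ((measurable_indicator_eq (hY _) j).sub_const _)

lemma IsMarkovChainFrom.ae_avg_pairDeviation (hM : IsMarkovChainFrom P W m Y)
    (hW : W ∈ Matrix.rowStochastic ℝ V) (hY : ∀ s, Measurable (Y s)) :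
    ∀ᵐ ω ∂P, ∀ v i j, Tendsto
      (fun n : ℕ => (∑ s ∈ range n, pairDeviation W v i j (fun s => Y s ω) s) / n)
      atTop (𝓝 0) := by
  simp only [ae_all_iff]
  intro v i j
  refine ae_tendsto_avg_zero (fun s => measurable_pairDeviation hY v i j s)
    (fun s ω => abs_pairDeviation_le hW v i j _ s) (v := v) fun s t hst => ?_
  refine hM.integral_mul_pairDeviation hW hY v t i j (fun y => pairDeviation W v i j y s) ?_
  intro x y hxy
  simp only [pairDeviation, hxy s (by omega), hxy (s + v) hst]

/-- The two-time marginals of the chain. -/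
lemma IsMarkovChainFrom.integral_pair (hM : IsMarkovChainFrom P W m Y)
    (hW : W ∈ Matrix.rowStochastic ℝ V) (hY : ∀ s, Measurable (Y s)) (s v : ℕ) (i j : V) :
    ∫ ω, (if Y s ω = i ∧ Y (s + v) ω = j then (1 : ℝ) else 0) ∂P
      = (W ^ s) m i * (W ^ v) i j := by
  have hI : ∀ t l, Integrable (fun ω => if Y t ω = l then (1 : ℝ) else 0) P := fun t l =>
    integrable_of_abs_le (C := 1) (measurable_indicator_eq (hY t) l)
      fun ω => by split_ifs <;> simp
  have hstart : ∀ᵐ ω ∂P, Y 0 ω = m := by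
    have h := hM 0 fun _ => m
    simp only [if_true, range_zero, prod_empty, mul_one] at h
    have h' : P {ω | ∀ t ≤ 0, Y t ω = m} = 1 := by
      rw [← ENNReal.toReal_eq_one_iff]
      exact h
    rw [ae_iff_prob_eq_one]
    · simpa using h'
    · exact (measurableSet_setOfPred.1 (hY 0 (measurableSet_singleton m)))
  have hone : ∫ ω, (if Y s ω = i then (1 : ℝ) else 0) ∂P = (W ^ s) m i := by
    have h := hM.integral_mul_pairDeviation hW hY s 0 m i (fun _ => 1) fun _ _ _ => rfl
    rw [integral_congr_ae (g := fun ω => (if Y s ω = i then (1 : ℝ) else 0) - (W ^ s) m i)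
      (by filter_upwards [hstart] with ω hω; simp [pairDeviation, hω]),
      integral_sub (hI s i) (integrable_const _)] at h
    simpa [sub_eq_zero] using h
  have h := hM.integral_mul_pairDeviation hW hY v s i j (fun _ => 1) fun _ _ _ => rfl
  have hadd : ∀ ω, (if Y s ω = i ∧ Y (s + v) ω = j then (1 : ℝ) else 0)
      = 1 * pairDeviation W v i j (fun s => Y s ω) s
        + (if Y s ω = i then (1 : ℝ) else 0) * (W ^ v) i j := by
    intro ω
    rw [pairDeviation]
    by_cases h1 : Y s ω = i <;> by_cases h2 : Y (s + v) ω = j <;> simp [h1, h2]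
  rw [integral_congr_ae (Eventually.of_forall hadd), integral_add, h, zero_add,
    integral_mul_const, hone]
  · exact integrable_of_abs_le (C := 1) ((measurable_pairDeviation hY v i j s).const_mul 1)
      fun ω => by rw [one_mul]; exact abs_pairDeviation_le hW v i j _ s
  · exact (hI s i).mul_const _

end Markov

/-! ### Averages over independent walks -/

section Independent

variable {Ω : Type*} [MeasurableSpace Ω] {P : Measure Ω} [IsProbabilityMeasure P]
  {V : Type*} [Fintype V] [DecidableEq V] [MeasurableSpace V] [MeasurableSingletonClass V]
  {W : Matrix V V ℝ}

lemma IsSampling.ae_avg_walks {k : ℕ} {X : V → ℕ → ℕ → Ω → V}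
    {Z : ℕ → ℕ → V × ℕ × ℕ × ℕ × ℕ → Ω → V} (h : IsSampling P W k X Z)
    (hW : W ∈ Matrix.rowStochastic ℝ V) :
    ∀ᵐ ω ∂P, ∀ m s v i j, Tendsto (fun r : ℕ => (∑ p ∈ range r,
      if X m p s ω = i ∧ X m p (s + v) ω = j then (1 : ℝ) else 0) / r)
      atTop (𝓝 ((W ^ s) m i * (W ^ v) i j)) := by
  simp only [ae_all_iff]
  intro m s v i j
  let f : (ℕ → V) → ℝ := fun y =>
    (if y s = i ∧ y (s + v) = j then (1 : ℝ) else 0) - (W ^ s) m i * (W ^ v) i j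
  have hf : Measurable f := by
    refine (Measurable.ite ?_ measurable_const measurable_const).sub_const _
    have hcoord : ∀ (t : ℕ) (l : V), MeasurableSet {y : ℕ → V | y t = l} := fun t l => by
      have ht : Measurable fun y : ℕ → V => y t := measurable_pi_apply t
      exact ht (measurableSet_singleton l)
    exact (hcoord s i).inter (hcoord (s + v) j)
  have hwalk : ∀ p, Measurable fun ω t => X m p t ω := fun p =>
    measurable_pi_lambda _ fun t => h.measurable_walk m p t
  have hbd : ∀ y, |f y| ≤ 1 := fun y => by
    have h0 : 0 ≤ (W ^ s) m i * (W ^ v) i j :=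
      mul_nonneg (Matrix.nonneg_of_mem_rowStochastic (pow_mem hW s))
        (Matrix.nonneg_of_mem_rowStochastic (pow_mem hW v))
    have h1 : (W ^ s) m i * (W ^ v) i j ≤ 1 :=
      mul_le_one₀ (Matrix.le_one_of_mem_rowStochastic (pow_mem hW s))
        (Matrix.nonneg_of_mem_rowStochastic (pow_mem hW v))
        (Matrix.le_one_of_mem_rowStochastic (pow_mem hW v))
    simp only [f]
    rw [abs_le]
    split_ifs <;> constructor <;> linarith
  have hmean : ∀ p, ∫ ω, f (fun t => X m p t ω) ∂P = 0 := fun p => by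
    have hp := (h.markov m p).integral_pair hW (h.measurable_walk m p) s v i j
    simp only [f]
    rw [integral_sub _ (integrable_const _), hp]
    · simp
    · refine integrable_of_abs_le (C := 1) (Measurable.ite ?_ measurable_const measurable_const)
        fun ω => by split_ifs <;> simp
      exact (h.measurable_walk m p s (measurableSet_singleton i)).inter
        (h.measurable_walk m p (s + v) (measurableSet_singleton j))
  have key := ae_tendsto_avg_zero (P := P) (ξ := fun p ω => f fun t => X m p t ω)
    (fun p => hf.comp (hwalk p)) (C := 1) (fun p ω => hbd fun t => X m p t ω) (v := 1)
    (fun p q hpq => by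
      have hind := (h.indep.indepFun (show (m, p) ≠ (m, q) from fun he => by
        have := (Prod.mk.injEq _ _ _ _ ▸ he).2
        omega)).comp hf hf
      have := hind.integral_mul_eq_mul_integral (hf.comp (hwalk p)).aestronglyMeasurable
        (hf.comp (hwalk q)).aestronglyMeasurable
      simp only [Pi.mul_apply, Function.comp_apply, hmean, mul_zero] at this
      exact this)
  filter_upwards [key] with ω hω
  have h2 := hω.add_const ((W ^ s) m i * (W ^ v) i j)
  rw [zero_add] at h2
  refine h2.congr' (eventually_atTop.2 ⟨1, fun r hr => ?_⟩)
  have hr' : (r : ℝ) ≠ 0 := by positivity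
  simp only [f, sum_sub_distrib, sum_const, card_range, nsmul_eq_mul]
  field_simp
  ring

end Independent

/-! ### Concentration of the negative samples -/

/-- Fourth moments of order `n ^ 2` give almost sure convergence after division by `n`, whatever
the joint law. -/
lemma ae_tendsto_div_of_pow_four {Ω : Type*} [MeasurableSpace Ω] {P : Measure Ω}
    {D : ℕ → Ω → ℝ} {C : ℝ}
    (hi : ∀ n, 1 ≤ n → Integrable (fun ω => D n ω ^ 4) P)
    (hD : ∀ n, 1 ≤ n → ∫ ω, D n ω ^ 4 ∂P ≤ C * (n : ℝ) ^ 2) :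
    ∀ᵐ ω ∂P, Tendsto (fun n : ℕ => D n ω / n) atTop (𝓝 0) := by
  have heven : Even 4 := by decide
  have hbd : ∀ n : ℕ, ∫ ω, (D (n + 1) ω / ((n + 1 : ℕ) : ℝ)) ^ 4 ∂P
      ≤ C * (1 / ((n + 1 : ℕ) : ℝ) ^ 2) := fun n => by
    have hp : (0 : ℝ) < ((n + 1 : ℕ) : ℝ) := by positivity
    simp only [div_pow]
    rw [integral_div, div_le_iff₀ (by positivity)]
    refine (hD (n + 1) (by omega)).trans (le_of_eq ?_)
    field_simp
  have hs : Summable fun n : ℕ => ∫ ω, (D (n + 1) ω / ((n + 1 : ℕ) : ℝ)) ^ 4 ∂P :=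
    Summable.of_nonneg_of_le (fun n => integral_nonneg fun ω => heven.pow_nonneg _) hbd
      (((summable_nat_add_iff 1).2 (Real.summable_one_div_nat_pow.2 one_lt_two)).mul_left C)
  have hint : ∀ n : ℕ, Integrable (fun ω => (D (n + 1) ω / ((n + 1 : ℕ) : ℝ)) ^ 4) P := fun n => by
    simp only [div_pow]
    exact (hi (n + 1) (by omega)).div_const _
  filter_upwards [ae_tendsto_zero_of_summable_integral hint (fun n ω => heven.pow_nonneg _) hs]
    with ω hω
  refine (tendsto_add_atTop_iff_nat 1).1 ((tendsto_zero_iff_abs_tendsto_zero _).2 ?_)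
  have h2 := hω.sqrt.sqrt
  simp only [Real.sqrt_zero] at h2
  refine h2.congr fun n => ?_
  rw [show ∀ y : ℝ, y ^ 4 = (y ^ 2) ^ 2 from fun y => pow_mul y 2 2, Real.sqrt_sq (sq_nonneg _),
    Real.sqrt_sq_eq_abs]
  rfl

section Negative

variable {V : Type*} [Fintype V] [DecidableEq V]

/-- Number of occurrences of `i` that have a node `v` steps later, in the first `ℓ` positions of
the first `r` walks from every node. -/
noncomputable def sourceCountAt (x : V → ℕ → ℕ → V) (i : V) (r ℓ v : ℕ) : ℝ :=
  ∑ m, ∑ p ∈ range r, ∑ s ∈ range (ℓ - v), if x m p s = i then (1 : ℝ) else 0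

/-- Deviation of the negative count at distance `v` from its conditional expectation given the
walks. -/
noncomputable def negDeviation (k : ℕ) (x : V → ℕ → ℕ → V) (z : V × ℕ × ℕ × ℕ × ℕ → V) (i j : V)
    (r ℓ v : ℕ) : ℝ :=
  negCountAt k x z i j r ℓ v - k * sourceCountAt x i r ℓ v * unigram r ℓ x j

/-- Indicator that the slot `q` belongs to the distance `v` and that its first node is `i`. -/
noncomputable def slotWeight (x : V → ℕ → ℕ → V) (i : V) (v : ℕ) (q : V × ℕ × ℕ × ℕ × ℕ) : ℝ :=
  if q.2.2.2.1 = v ∧ x q.1 q.2.1 q.2.2.1 = i then 1 else 0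

lemma sum_negSlots {r ℓ k v : ℕ} (hv : 1 ≤ v) (x : V → ℕ → ℕ → V) (i : V)
    (g : V × ℕ × ℕ × ℕ × ℕ → ℝ) :
    ∑ q ∈ negSlots V r ℓ k, slotWeight x i v q * g q
      = ∑ m, ∑ p ∈ range r, ∑ s ∈ range (ℓ - v), ∑ c ∈ range k,
          (if x m p s = i then 1 else 0) * g (m, p, s, v, c) := by
  simp only [negSlots, sum_filter, sum_product]
  refine sum_congr rfl fun m _ => sum_congr rfl fun p _ => ?_
  have hr : range (ℓ - v) = (range ℓ).filter (fun s => s + v < ℓ) := by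
    ext s
    simp only [mem_range, mem_filter]
    omega
  rw [hr, sum_filter]
  refine sum_congr rfl fun s _ => ?_
  by_cases h : s + v < ℓ
  · rw [if_pos h, sum_eq_single v]
    · refine sum_congr rfl fun c _ => ?_
      simp [hv, h, slotWeight]
    · intro v' _ hne
      simp [slotWeight, hne]
    · intro hn
      exact absurd (mem_range.2 (by omega)) hn
  · rw [if_neg h]
    refine sum_eq_zero fun v' _ => sum_eq_zero fun c _ => ?_
    by_cases hv' : v' = v
    · subst hv'
      simp [h]
    · simp [slotWeight, hv']

lemma negDeviation_eq_sum {r ℓ k v : ℕ} (hv : 1 ≤ v) (x : V → ℕ → ℕ → V)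
    (z : V × ℕ × ℕ × ℕ × ℕ → V) (i j : V) :
    negDeviation k x z i j r ℓ v = ∑ q ∈ negSlots V r ℓ k,
      slotWeight x i v q * ((if z q = j then 1 else 0) - unigram r ℓ x j) := by
  rw [sum_negSlots hv x i, negDeviation, negCountAt, sourceCountAt]
  simp only [mul_sub, sum_sub_distrib, sum_const, card_range, nsmul_eq_mul, ← mul_sum, ← sum_mul,
    mul_assoc]
  congr 1
  refine sum_congr rfl fun m _ => sum_congr rfl fun p _ => sum_congr rfl fun s _ => ?_
  by_cases h1 : x m p s = i <;> simp [h1]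

lemma sourceCountAt_le (x : V → ℕ → ℕ → V) (i : V) (r ℓ v : ℕ) :
    sourceCountAt x i r ℓ v ≤ Fintype.card V * r * ℓ := by
  calc sourceCountAt x i r ℓ v
      ≤ ∑ m : V, ∑ p ∈ range r, ∑ s ∈ range (ℓ - v), (1 : ℝ) :=
        sum_le_sum fun m _ => sum_le_sum fun p _ => sum_le_sum fun s _ => by
          split_ifs <;> norm_num
    _ = Fintype.card V * r * (ℓ - v : ℕ) := by simp [mul_assoc]
    _ ≤ _ := by
        gcongr
        omega

lemma sum_slotWeight_le {r ℓ k v : ℕ} (hv : 1 ≤ v) (x : V → ℕ → ℕ → V) (i : V) :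
    ∑ q ∈ negSlots V r ℓ k, slotWeight x i v q ≤ Fintype.card V * r * ℓ * k := by
  have h := sum_negSlots (r := r) (ℓ := ℓ) (k := k) hv x i fun _ => 1
  simp only [mul_one, sum_const, card_range, nsmul_eq_mul, ← mul_sum] at h
  rw [h, mul_comm]
  gcongr
  exact sourceCountAt_le x i r ℓ v

lemma unigram_mem_stdSimplex [Nonempty V] {r ℓ : ℕ} (hr : 1 ≤ r) (hℓ : 1 ≤ ℓ)
    (x : V → ℕ → ℕ → V) : unigram r ℓ x ∈ stdSimplex ℝ V := by
  refine ⟨fun j => ?_, ?_⟩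
  · exact div_nonneg (sum_nonneg fun m _ => sum_nonneg fun p _ => sum_nonneg fun s _ => by
      split_ifs <;> norm_num) (by positivity)
  · have h1 : (r : ℝ) ≠ 0 := by positivity
    have h2 : (ℓ : ℝ) ≠ 0 := by positivity
    simp only [unigram, ← sum_div]
    rw [sum_comm, sum_congr rfl fun m _ => sum_comm,
      sum_congr rfl fun m _ => sum_congr rfl fun p _ => sum_comm]
    simp only [sum_ite_eq, mem_univ, if_true, sum_const, card_range, card_univ, nsmul_eq_mul]
    field_simp

/-- Exponential moment of a centred indicator. -/
lemma sum_mul_exp_centered_le {u : V → ℝ} (hu : u ∈ stdSimplex ℝ V) {θ : ℝ} (hθ : |θ| ≤ 1)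
    (j : V) : ∑ y, u y * Real.exp (θ * ((if y = j then 1 else 0) - u j)) ≤ Real.exp (θ ^ 2) := by
  have hj0 := hu.1 j
  have hj1 := (abs_le.1 (abs_le_one_of_mem_stdSimplex hu j)).2
  have hterm : ∀ y, Real.exp (θ * ((if y = j then 1 else 0) - u j))
      ≤ 1 + θ * ((if y = j then 1 else 0) - u j) + θ ^ 2 := by
    intro y
    have hc : |(if y = j then 1 else 0) - u j| ≤ 1 := by
      rw [abs_le]
      split_ifs <;> constructor <;> linarith
    have ha : |θ * ((if y = j then 1 else 0) - u j)| ≤ 1 := by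
      rw [abs_mul]
      exact mul_le_one₀ hθ (abs_nonneg _) hc
    have h1 := (abs_le.1 (Real.abs_exp_sub_one_sub_id_le ha)).2
    have h2 : (θ * ((if y = j then 1 else 0) - u j)) ^ 2 ≤ θ ^ 2 := by
      rw [mul_pow]
      exact mul_le_of_le_one_right (sq_nonneg _) ((sq_le_one_iff_abs_le_one _).2 hc)
    linarith
  calc _ ≤ ∑ y, u y * (1 + θ * ((if y = j then 1 else 0) - u j) + θ ^ 2) :=
        sum_le_sum fun y _ => mul_le_mul_of_nonneg_left (hterm y) (hu.1 y)
    _ = ∑ y, (u y * (1 - θ * u j + θ ^ 2) + if y = j then θ * u y else 0) :=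
        sum_congr rfl fun y _ => by split_ifs <;> ring
    _ = θ ^ 2 + 1 := by
        rw [sum_add_distrib, ← sum_mul, hu.2, sum_ite_eq' univ j, if_pos (mem_univ j)]
        ring
    _ ≤ _ := Real.add_one_le_exp _

variable [MeasurableSpace V] [MeasurableSingletonClass V] {Ω : Type*} [MeasurableSpace Ω]
  {P : Measure Ω} [IsProbabilityMeasure P] {W : Matrix V V ℝ} {k : ℕ}
  {X : V → ℕ → ℕ → Ω → V} {Z : ℕ → ℕ → V × ℕ × ℕ × ℕ × ℕ → Ω → V}

/-- Exponential moments of the deviation. Conditionally on the walks it is a sum of independent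
centred variables, so the moment is a product of one-slot moments. Since the deviation factors
through the finite set of values of the walks and samples, all its moments exist. -/
lemma IsSampling.moments_negDeviation [Nonempty V] (h : IsSampling P W k X Z) {r ℓ v : ℕ}
    (hr : 1 ≤ r) (hℓ : 1 ≤ ℓ) (hv : 1 ≤ v) (i j : V) (φ : ℝ → ℝ) :
    Integrable (fun ω => φ
      (negDeviation k (fun m p s => X m p s ω) (fun q => Z r ℓ q ω) i j r ℓ v)) P ∧
    ∀ t : ℝ, |t| ≤ 1 → ∫ ω, Real.exp
        (t * negDeviation k (fun m p s => X m p s ω) (fun q => Z r ℓ q ω) i j r ℓ v) ∂P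
      ≤ Real.exp (t ^ 2 * (Fintype.card V * r * ℓ * k)) := by
  let S := negSlots V r ℓ k
  let A := V → Fin r → Fin ℓ → V
  -- the values outside the first `ℓ` positions of the first `r` walks are irrelevant
  let ext : A → V → ℕ → ℕ → V := fun a m p s =>
    if h : p < r ∧ s < ℓ then a m ⟨p, h.1⟩ ⟨s, h.2⟩ else m
  let Ψ : Ω → A := fun ω m p s => X m p s ω
  let Φ : Ω → A × (S → V) := fun ω => (Ψ ω, fun q => Z r ℓ q ω)
  have hΨ : Measurable Ψ := measurable_pi_lambda _ fun m => measurable_pi_lambda _ fun p =>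
    measurable_pi_lambda _ fun s => h.measurable_walk m p s
  have hΦ : Measurable Φ := hΨ.prodMk
    (measurable_pi_lambda (fun ω (q : S) => Z r ℓ q ω) fun q => h.measurable_neg r ℓ q)
  have hext : ∀ ω m, ∀ p < r, ∀ s < ℓ, ext (Ψ ω) m p s = X m p s ω := by
    intro ω m p hp s hs
    simp [ext, Ψ, hp, hs]
  have hΨiff : ∀ ω a, Ψ ω = a ↔ ∀ m, ∀ p < r, ∀ s < ℓ, X m p s ω = ext a m p s := by
    intro ω a
    constructor
    · rintro rfl m p hp s hs
      exact (hext ω m p hp s hs).symm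
    · intro hx
      ext m p s
      simpa [ext] using hx m p p.2 s s.2
  let w : A → S → ℝ := fun a q => slotWeight (ext a) i v q
  let u : A → V → ℝ := fun a => unigram r ℓ (ext a)
  have hu : ∀ a, u a ∈ stdSimplex ℝ V := fun a => unigram_mem_stdSimplex hr hℓ _
  let D : A × (S → V) → ℝ := fun b =>
    ∑ q : S, w b.1 q * ((if b.2 q = j then 1 else 0) - u b.1 j)
  have hD : ∀ ω, negDeviation k (fun m p s => X m p s ω) (fun q => Z r ℓ q ω) i j r ℓ v
      = D (Φ ω) := by
    intro ω
    have huni : unigram r ℓ (fun m p s => X m p s ω) j = u (Ψ ω) j := by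
      simp only [u, unigram]
      congr 1
      refine sum_congr rfl fun m _ => sum_congr rfl fun p hp => sum_congr rfl fun s hs => ?_
      rw [hext ω m p (mem_range.1 hp) s (mem_range.1 hs)]
    rw [negDeviation_eq_sum hv, huni, ← sum_coe_sort]
    refine sum_congr rfl fun q _ => ?_
    have hq := q.2
    simp only [negSlots, mem_filter, mem_product, mem_range, mem_univ, true_and] at hq
    have hw : slotWeight (fun m p s => X m p s ω) i v q = w (Ψ ω) q := by
      simp only [w, slotWeight]
      rw [hext ω _ _ hq.1.1 _ hq.1.2.1]
    rw [hw]
  simp only [hD]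
  refine ⟨?_, fun t ht => ?_⟩
  · have : IsProbabilityMeasure (P.map Φ) := Measure.isProbabilityMeasure_map hΦ.aemeasurable
    exact (Integrable.of_finite (μ := P.map Φ) (f := fun b => φ (D b))).comp_measurable hΦ
  rw [integral_comp_fintype hΦ fun b => Real.exp (t * D b), Fintype.sum_prod_type]
  have hprob : ∀ a b, P.real {ω | Φ ω = (a, b)} = P.real {ω | Ψ ω = a} * ∏ q : S, u a (b q) := by
    intro a b
    let z : V × ℕ × ℕ × ℕ × ℕ → V := fun q => if hq : q ∈ S then b ⟨q, hq⟩ else q.1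
    have hlaw := h.neg_law r ℓ (ext a) z
    rw [← prod_coe_sort] at hlaw
    have h1 : {ω | Φ ω = (a, b)} = {ω | (∀ m, ∀ p < r, ∀ s < ℓ, X m p s ω = ext a m p s) ∧
        ∀ q ∈ negSlots V r ℓ k, Z r ℓ q ω = z q} := by
      ext ω
      simp only [Set.mem_ofPred_eq, Φ, Prod.mk.injEq, hΨiff, funext_iff (g := b)]
      refine and_congr_right fun _ => ⟨fun hb q hq => ?_, fun hb q => ?_⟩
      · simpa [z, S, hq] using hb ⟨q, hq⟩
      · have := hb q q.2
        simpa [z] using this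
    have h2 : {ω | Ψ ω = a} = {ω | ∀ m, ∀ p < r, ∀ s < ℓ, X m p s ω = ext a m p s} := by
      ext ω
      simp only [Set.mem_ofPred_eq, hΨiff]
    rw [h1, h2, hlaw]
    congr 1
    refine prod_congr rfl fun q _ => ?_
    simp [z, u]
  have hcond : ∀ a, ∑ b : S → V, (∏ q : S, u a (b q)) * Real.exp (t * D (a, b))
      ≤ Real.exp (t ^ 2 * (Fintype.card V * r * ℓ * k)) := by
    intro a
    calc _ = ∑ b : S → V, ∏ q : S,
          (u a (b q) * Real.exp (t * w a q * ((if b q = j then 1 else 0) - u a j))) := by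
          refine sum_congr rfl fun b _ => ?_
          rw [prod_mul_distrib, ← Real.exp_sum, mul_sum]
          simp only [mul_assoc]
      _ = ∏ q : S, ∑ y, u a y * Real.exp (t * w a q * ((if y = j then 1 else 0) - u a j)) :=
          (Fintype.prod_sum fun (q : S) y =>
            u a y * Real.exp (t * w a q * ((if y = j then 1 else 0) - u a j))).symm
      _ ≤ ∏ q : S, Real.exp (t ^ 2 * w a q) := by
          refine prod_le_prod (fun q _ => sum_nonneg fun y _ =>
            mul_nonneg ((hu a).1 y) (Real.exp_pos _).le) fun q _ => ?_
          have hw : w a q = 0 ∨ w a q = 1 := by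
            simp only [w, slotWeight]
            split_ifs <;> simp
          have hsq : (t * w a q) ^ 2 = t ^ 2 * w a q := by
            rcases hw with hw | hw <;> simp [hw]
          rw [← hsq]
          refine sum_mul_exp_centered_le (hu a) ?_ j
          rcases hw with hw | hw <;> simp [hw, ht]
      _ = Real.exp (t ^ 2 * ∑ q ∈ negSlots V r ℓ k, slotWeight (ext a) i v q) := by
          rw [← Real.exp_sum, ← mul_sum,
            ← sum_coe_sort S fun q => slotWeight (ext a) i v q]
      _ ≤ _ := by
          gcongr
          exact sum_slotWeight_le hv _ i
  calc _ = ∑ a, P.real {ω | Ψ ω = a}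
        * ∑ b : S → V, (∏ q : S, u a (b q)) * Real.exp (t * D (a, b)) := by
        refine sum_congr rfl fun a _ => ?_
        rw [mul_sum]
        exact sum_congr rfl fun b _ => by rw [hprob, mul_assoc]
    _ ≤ ∑ a, P.real {ω | Ψ ω = a} * Real.exp (t ^ 2 * (Fintype.card V * r * ℓ * k)) :=
        sum_le_sum fun a _ => mul_le_mul_of_nonneg_left (hcond a) measureReal_nonneg
    _ = _ := by
        rw [← integral_comp_fintype hΨ fun _ => Real.exp (t ^ 2 * (Fintype.card V * r * ℓ * k))]
        simp

/-- Fourth moment of the deviation, from its exponential moments at the scale of the square root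
of the number of slots. -/
lemma IsSampling.integral_negDeviation_pow_four [Nonempty V] (h : IsSampling P W k X Z)
    {r ℓ v : ℕ} (hr : 1 ≤ r) (hℓ : 1 ≤ ℓ) (hv : 1 ≤ v) (i j : V) :
    ∫ ω, negDeviation k (fun m p s => X m p s ω) (fun q => Z r ℓ q ω) i j r ℓ v ^ 4 ∂P
      ≤ 48 * Real.exp 1 * (Fintype.card V * r * ℓ * (k + 1)) ^ 2 := by
  -- `k + 1` instead of `k` keeps the scale `T` positive when there are no negative samples
  set T : ℝ := Fintype.card V * r * ℓ * (k + 1) with hT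
  set D : Ω → ℝ := fun ω =>
    negDeviation k (fun m p s => X m p s ω) (fun q => Z r ℓ q ω) i j r ℓ v
  have hT1 : 1 ≤ T := by
    have : 1 ≤ Fintype.card V * r * ℓ * (k + 1) :=
      Nat.succ_le_of_lt (by have := Fintype.card_pos (α := V); positivity)
    rw [hT]
    exact_mod_cast this
  have hT0 : 0 < T := by linarith
  have hs0 : 0 < √T := Real.sqrt_pos.2 hT0
  have hs1 : |1 / √T| ≤ 1 := by
    rw [abs_of_pos (by positivity), div_le_one hs0]
    exact Real.one_le_sqrt.2 hT1
  have hexp : ∀ t : ℝ, |t| ≤ 1 → t ^ 2 = 1 / T → ∫ ω, Real.exp (t * D ω) ∂P ≤ Real.exp 1 := by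
    intro t ht ht2
    refine ((h.moments_negDeviation hr hℓ hv i j id).2 t ht).trans (Real.exp_le_exp.2 ?_)
    rw [ht2, one_div, inv_mul_le_iff₀ hT0, mul_one, hT]
    gcongr
    linarith
  have hsq : (1 / √T) ^ 2 = 1 / T := by rw [div_pow, one_pow, Real.sq_sqrt hT0.le]
  have h1 := hexp (1 / √T) hs1 hsq
  have h2 := hexp (-(1 / √T)) (by rwa [abs_neg]) (by rwa [neg_sq])
  have hi : ∀ t, Integrable (fun ω => Real.exp (t * D ω)) P := fun t =>
    (h.moments_negDeviation hr hℓ hv i j fun y => Real.exp (t * y)).1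
  have hpt : ∀ ω, D ω ^ 4 ≤ 24 * T ^ 2 *
      (Real.exp (1 / √T * D ω) + Real.exp (-(1 / √T) * D ω)) := by
    intro ω
    have hy := Real.pow_div_factorial_le_exp |1 / √T * D ω| (abs_nonneg _) 4
    have hab : Real.exp |1 / √T * D ω|
        ≤ Real.exp (1 / √T * D ω) + Real.exp (-(1 / √T) * D ω) := by
      rw [neg_mul]
      rcases abs_choice (1 / √T * D ω) with hc | hc <;> rw [hc]
      · exact le_add_of_nonneg_right (Real.exp_pos _).le
      · exact le_add_of_nonneg_left (Real.exp_pos _).le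
    have hpow : |1 / √T * D ω| ^ 4 = D ω ^ 4 / T ^ 2 := by
      rw [(show Even 4 by decide).pow_abs, mul_pow,
        show (1 / √T) ^ 4 = ((1 / √T) ^ 2) ^ 2 from pow_mul _ 2 2, hsq]
      rw [div_pow, one_pow, one_div_mul_eq_div]
    rw [hpow, show ((Nat.factorial 4 : ℕ) : ℝ) = 24 by norm_num [Nat.factorial], div_div,
      div_le_iff₀ (by positivity)] at hy
    nlinarith [mul_le_mul_of_nonneg_left hab (show 0 ≤ 24 * T ^ 2 by positivity)]
  calc ∫ ω, D ω ^ 4 ∂P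
      ≤ ∫ ω, 24 * T ^ 2 * (Real.exp (1 / √T * D ω) + Real.exp (-(1 / √T) * D ω)) ∂P :=
        integral_mono (h.moments_negDeviation hr hℓ hv i j fun y => y ^ 4).1
          (((hi _).add (hi _)).const_mul _) hpt
    _ = 24 * T ^ 2 * (∫ ω, Real.exp (1 / √T * D ω) ∂P
          + ∫ ω, Real.exp (-(1 / √T) * D ω) ∂P) := by
        rw [integral_const_mul, integral_add (hi _) (hi _)]
    _ ≤ 24 * T ^ 2 * (Real.exp 1 + Real.exp 1) := by gcongr
    _ = _ := by ring

lemma IsSampling.ae_negDeviation_length [Nonempty V] (h : IsSampling P W k X Z) :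
    ∀ᵐ ω ∂P, ∀ r v i j, 1 ≤ r → 1 ≤ v → Tendsto (fun ℓ : ℕ =>
      negDeviation k (fun m p s => X m p s ω) (fun q => Z r ℓ q ω) i j r ℓ v / ℓ)
      atTop (𝓝 0) := by
  simp only [ae_all_iff]
  intro r v i j hr hv
  refine ae_tendsto_div_of_pow_four (C := 48 * Real.exp 1 * (Fintype.card V * r * (k + 1)) ^ 2)
    (fun ℓ hℓ => (h.moments_negDeviation hr hℓ hv i j fun y => y ^ 4).1) fun ℓ hℓ => ?_
  refine (h.integral_negDeviation_pow_four hr hℓ hv i j).trans (le_of_eq ?_)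
  ring

lemma IsSampling.ae_negDeviation_walks [Nonempty V] (h : IsSampling P W k X Z) :
    ∀ᵐ ω ∂P, ∀ ℓ v i j, 1 ≤ ℓ → 1 ≤ v → Tendsto (fun r : ℕ =>
      negDeviation k (fun m p s => X m p s ω) (fun q => Z r ℓ q ω) i j r ℓ v / r)
      atTop (𝓝 0) := by
  simp only [ae_all_iff]
  intro ℓ v i j hℓ hv
  refine ae_tendsto_div_of_pow_four (C := 48 * Real.exp 1 * (Fintype.card V * ℓ * (k + 1)) ^ 2)
    (fun r hr => (h.moments_negDeviation hr hℓ hv i j fun y => y ^ 4).1) fun r hr => ?_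
  refine (h.integral_negDeviation_pow_four hr hℓ hv i j).trans (le_of_eq ?_)
  ring

end Negative

/-! ### Limits of the counts along a typical outcome -/

section Limits

variable {V : Type*} [Fintype V]

/-- Many positions: if the time average along every walk tends to `c`, the total over the walks
does so with weight the number of walks. -/
lemma tendsto_total_div_length {f : V → ℕ → ℕ → ℝ} {c C : ℝ} (hf : ∀ m p s, |f m p s| ≤ C)
    (h : ∀ m p, Tendsto (fun n : ℕ => (∑ s ∈ range n, f m p s) / n) atTop (𝓝 c)) (r v : ℕ) :
    Tendsto (fun ℓ : ℕ => (∑ m, ∑ p ∈ range r, ∑ s ∈ range (ℓ - v), f m p s) / ℓ)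
      atTop (𝓝 (Fintype.card V * r * c)) := by
  have h1 := tendsto_finsetSum univ fun m _ => tendsto_finsetSum (range r) fun p _ =>
    tendsto_avg_sub (hf m p) v (h m p)
  simp only [sum_const, card_range, card_univ, nsmul_eq_mul, ← mul_assoc] at h1
  simpa only [← sum_div] using h1

/-- Many walks: the averages over the walks from each node may be summed over finitely many
positions. -/
lemma tendsto_total_div_walks {f : V → ℕ → ℕ → ℝ} {c : V → ℕ → ℝ}
    (h : ∀ m s, Tendsto (fun r : ℕ => (∑ p ∈ range r, f m p s) / r) atTop (𝓝 (c m s))) (N : ℕ) :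
    Tendsto (fun r : ℕ => (∑ m, ∑ p ∈ range r, ∑ s ∈ range N, f m p s) / r)
      atTop (𝓝 (∑ m, ∑ s ∈ range N, c m s)) := by
  have h1 := tendsto_finsetSum univ fun m _ => tendsto_finsetSum (range N) fun s _ => h m s
  refine h1.congr fun r => ?_
  simp only [← sum_div]
  congr 1
  exact sum_congr rfl fun m _ => sum_comm

variable [DecidableEq V] {W : Matrix V V ℝ} {π : V → ℝ} {α : ℕ+ → ℝ} {k : ℕ}

/-- Mean number of positions `s < ℓ - v` at the node `i`, per walk and position. -/
noncomputable def sourceMean (W : Matrix V V ℝ) (i : V) (ℓ v : ℕ) : ℝ :=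
  1 / (ℓ * Fintype.card V) * ∑ m, ∑ s ∈ range (ℓ - v), (W ^ s) m i

lemma abs_sum_pow_le (hW : W ∈ Matrix.rowStochastic ℝ V) (m i : V) (ℓ v : ℕ) :
    |∑ s ∈ range (ℓ - v), (W ^ s) m i| ≤ ℓ := by
  calc _ ≤ ∑ s ∈ range (ℓ - v), |(W ^ s) m i| := abs_sum_le_sum_abs _ _
    _ ≤ ∑ s ∈ range (ℓ - v), (1 : ℝ) := sum_le_sum fun s _ => abs_pow_apply_le_one hW s m i
    _ = (ℓ - v : ℕ) := by simp
    _ ≤ ℓ := by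
        gcongr
        omega

/-- A total of at most `B` becomes a number of absolute value at most `1` after division by `B`,
also when `B = 0`. -/
lemma abs_one_div_mul_le_one {a B : ℝ} (hB : 0 ≤ B) (ha : |a| ≤ B) : |1 / B * a| ≤ 1 := by
  rw [one_div_mul_eq_div, abs_div, abs_of_nonneg hB]
  exact div_le_one_of_le₀ ha hB

lemma abs_sourceMean_le (hW : W ∈ Matrix.rowStochastic ℝ V) (i : V) (ℓ v : ℕ) :
    |sourceMean W i ℓ v| ≤ 1 := by
  refine abs_one_div_mul_le_one (by positivity) ((abs_sum_le_sum_abs _ _).trans ?_)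
  refine (sum_le_sum fun m _ => abs_sum_pow_le hW m i ℓ v).trans (le_of_eq ?_)
  rw [sum_const, card_univ, nsmul_eq_mul, mul_comm]

lemma tendsto_sourceMean [Nonempty V] (hW : W ∈ Matrix.rowStochastic ℝ V)
    (huniq : ∀ ν, IsStationary W ν → ν = π) (i : V) (v : ℕ) :
    Tendsto (fun ℓ : ℕ => sourceMean W i ℓ v) atTop (𝓝 (π i)) := by
  have hn : (Fintype.card V : ℝ) ≠ 0 := by simp
  have h := (tendsto_total_div_length (V := V) (f := fun m _ s => (W ^ s) m i)
    (fun m _ s => abs_pow_apply_le_one hW s m i)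
    (fun m _ => tendsto_avg_pow hW huniq m i) 1 v).const_mul (1 / (Fintype.card V : ℝ))
  have hlim : 1 / (Fintype.card V : ℝ) * (Fintype.card V * (1 : ℕ) * π i) = π i := by
    push_cast
    field_simp
  rw [hlim] at h
  refine h.congr fun ℓ => ?_
  simp only [sourceMean, sum_range_one]
  ring

lemma tsum_mul_sourceMean (hW : W ∈ Matrix.rowStochastic ℝ V) {β : ℕ+ → ℝ}
    (hβ : Summable fun v => |β v|) (i : V) (ℓ : ℕ) :
    1 / (ℓ * Fintype.card V : ℝ) * ∑ m, ∑' v : ℕ+, β v * ∑ s ∈ range (ℓ - v), (W ^ s) m i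
      = ∑' v : ℕ+, β v * sourceMean W i ℓ v := by
  rw [← Summable.tsum_finsetSum, ← tsum_mul_left]
  · refine tsum_congr fun v => ?_
    rw [sourceMean, ← mul_sum]
    ring
  · intro m _
    refine Summable.of_norm_bounded (hβ.mul_right (ℓ : ℝ)) fun v => ?_
    rw [Real.norm_eq_abs, abs_mul]
    gcongr
    exact abs_sum_pow_le hW m i ℓ v

lemma summable_abs_mul_pow (hW : W ∈ Matrix.rowStochastic ℝ V)
    (hα : Summable fun v => |α v|) (i j : V) :
    Summable fun v : ℕ+ => |α v * (W ^ (v : ℕ)) i j| := by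
  refine Summable.of_nonneg_of_le (fun v => abs_nonneg _) (fun v => ?_) hα
  rw [abs_mul]
  exact mul_le_of_le_one_right (abs_nonneg _) (abs_pow_apply_le_one hW v i j)

lemma posLimitLen_eq (hW : W ∈ Matrix.rowStochastic ℝ V) (hα : Summable fun v => |α v|)
    (i j : V) (ℓ : ℕ) :
    posLimitLen W α i j ℓ = ∑' v : ℕ+, α v * (W ^ (v : ℕ)) i j * sourceMean W i ℓ v :=
  tsum_mul_sourceMean hW (summable_abs_mul_pow hW hα i j) i ℓ

lemma negLimitLen_eq (hW : W ∈ Matrix.rowStochastic ℝ V) (hα : Summable fun v => |α v|)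
    (i j : V) (ℓ : ℕ) :
    negLimitLen W α k i j ℓ
      = k * cesaroUnigram W ℓ j * ∑' v : ℕ+, α v * sourceMean W i ℓ v := by
  rw [← tsum_mul_sourceMean hW hα i ℓ, negLimitLen]
  ring

lemma tendsto_posLimitLen [Nonempty V] (hW : W ∈ Matrix.rowStochastic ℝ V)
    (huniq : ∀ ν, IsStationary W ν → ν = π) (hα : Summable fun v => |α v|) (i j : V) :
    Tendsto (posLimitLen W α i j) atTop (𝓝 (posLimit W π α i j)) := by
  have h := tendsto_weighted_tsum (summable_abs_mul_pow hW hα i j)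
    (fun ℓ v => abs_sourceMean_le hW i ℓ v) fun v => tendsto_sourceMean hW huniq i v
  rw [tsum_mul_right, mul_comm] at h
  exact h.congr fun ℓ => (posLimitLen_eq hW hα i j ℓ).symm

lemma tendsto_negLimitLen [Nonempty V] (hW : W ∈ Matrix.rowStochastic ℝ V)
    (huniq : ∀ ν, IsStationary W ν → ν = π) (hα : Summable fun v => |α v|) (i j : V) :
    Tendsto (negLimitLen W α k i j) atTop (𝓝 (negLimit π α k i j)) := by
  have h := tendsto_weighted_tsum hα
    (fun ℓ v => abs_sourceMean_le hW i ℓ v) fun v => tendsto_sourceMean hW huniq i v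
  rw [tsum_mul_right] at h
  have h2 := ((tendsto_cesaroUnigram hW huniq j).const_mul (k : ℝ)).mul h
  have hlim : (k : ℝ) * π j * ((∑' v : ℕ+, α v) * π i) = negLimit π α k i j := by
    rw [negLimit]
    ring
  rw [hlim] at h2
  exact h2.congr fun ℓ => (negLimitLen_eq hW hα i j ℓ).symm

lemma abs_indicator_le_one (p : Prop) [Decidable p] : |if p then (1 : ℝ) else 0| ≤ 1 := by
  split_ifs <;> simp

lemma abs_posCountAt_le (x : V → ℕ → ℕ → V) (i j : V) (r ℓ v : ℕ) :
    |posCountAt x i j r ℓ v| ≤ r * Fintype.card V * ℓ := by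
  rw [abs_of_nonneg (sum_nonneg fun m _ => sum_nonneg fun p _ => sum_nonneg fun s _ => by
    split_ifs <;> norm_num)]
  refine le_trans (sum_le_sum fun m _ => sum_le_sum fun p _ => sum_le_sum fun s _ => ?_)
    ((sourceCountAt_le x i r ℓ v).trans (le_of_eq (by ring)))
  by_cases h1 : x m p s = i <;> by_cases h2 : x m p (s + v) = j <;> simp [h1, h2]

lemma abs_negCountAt_le (x : V → ℕ → ℕ → V) (z : V × ℕ × ℕ × ℕ × ℕ → V) (i j : V)
    (r ℓ v : ℕ) : |negCountAt k x z i j r ℓ v| ≤ r * Fintype.card V * ℓ * k := by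
  rw [abs_of_nonneg (sum_nonneg fun m _ => sum_nonneg fun p _ => sum_nonneg fun s _ =>
    sum_nonneg fun c _ => by split_ifs <;> norm_num)]
  have h : negCountAt k x z i j r ℓ v ≤ sourceCountAt x i r ℓ v * k := by
    rw [negCountAt, sourceCountAt]
    simp only [sum_mul]
    refine sum_le_sum fun m _ => sum_le_sum fun p _ => sum_le_sum fun s _ => ?_
    calc _ ≤ ∑ c ∈ range k, if x m p s = i then (1 : ℝ) else 0 :=
          sum_le_sum fun c _ => by
            by_cases h1 : x m p s = i <;> by_cases h2 : z (m, p, s, v, c) = j <;> simp [h1, h2]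
      _ = _ := by rw [sum_const, card_range, nsmul_eq_mul, mul_comm]
  refine h.trans ((mul_le_mul_of_nonneg_right (sourceCountAt_le x i r ℓ v)
    k.cast_nonneg).trans (le_of_eq (by ring)))

/-- The properties of an outcome, given by the walks `x` and the negative samples `z`, that
determine all limits of the counts: pair frequencies along every walk, pair frequencies over the
walks from every node, and negligible deviations of the negative counts. -/
structure IsTypical (W : Matrix V V ℝ) (π : V → ℝ) (k : ℕ) (x : V → ℕ → ℕ → V)
    (z : ℕ → ℕ → V × ℕ × ℕ × ℕ × ℕ → V) : Prop where
  along_walk : ∀ m p v i j, Tendsto (fun n : ℕ =>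
    (∑ s ∈ range n, if x m p s = i ∧ x m p (s + v) = j then (1 : ℝ) else 0) / n)
    atTop (𝓝 (π i * (W ^ v) i j))
  over_walks : ∀ m s v i j, Tendsto (fun r : ℕ =>
    (∑ p ∈ range r, if x m p s = i ∧ x m p (s + v) = j then (1 : ℝ) else 0) / r)
    atTop (𝓝 ((W ^ s) m i * (W ^ v) i j))
  neg_length : ∀ r v i j, 1 ≤ r → 1 ≤ v → Tendsto (fun ℓ : ℕ =>
    negDeviation k x (z r ℓ) i j r ℓ v / ℓ) atTop (𝓝 0)
  neg_walks : ∀ ℓ v i j, 1 ≤ ℓ → 1 ≤ v → Tendsto (fun r : ℕ =>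
    negDeviation k x (z r ℓ) i j r ℓ v / r) atTop (𝓝 0)

variable {x : V → ℕ → ℕ → V} {z : ℕ → ℕ → V × ℕ × ℕ × ℕ × ℕ → V}

namespace IsTypical

lemma visits_along_walk (h : IsTypical W π k x z) (m : V) (p : ℕ) (i : V) :
    Tendsto (fun n : ℕ => (∑ s ∈ range n, if x m p s = i then (1 : ℝ) else 0) / n)
      atTop (𝓝 (π i)) := by
  simpa using h.along_walk m p 0 i i

lemma visits_over_walks (h : IsTypical W π k x z) (m : V) (s : ℕ) (i : V) :
    Tendsto (fun r : ℕ => (∑ p ∈ range r, if x m p s = i then (1 : ℝ) else 0) / r)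
      atTop (𝓝 ((W ^ s) m i)) := by
  simpa using h.over_walks m s 0 i i

lemma unigram_length [Nonempty V] (h : IsTypical W π k x z) {r : ℕ} (hr : 1 ≤ r) (j : V) :
    Tendsto (fun ℓ : ℕ => unigram r ℓ x j) atTop (𝓝 (π j)) := by
  have hn : (Fintype.card V : ℝ) ≠ 0 := by simp
  have hr' : (r : ℝ) ≠ 0 := by positivity
  have h1 := (tendsto_total_div_length (fun m p s => abs_indicator_le_one (x m p s = j))
    (fun m p => h.visits_along_walk m p j) r 0).const_mul (1 / (Fintype.card V * r : ℝ))
  rw [one_div_mul_eq_div, mul_div_cancel_left₀ _ (mul_ne_zero hn hr')] at h1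
  refine h1.congr fun ℓ => ?_
  rw [unigram, Nat.sub_zero]
  ring

lemma unigram_walks (h : IsTypical W π k x z) (ℓ : ℕ) (j : V) :
    Tendsto (fun r : ℕ => unigram r ℓ x j) atTop (𝓝 (cesaroUnigram W ℓ j)) := by
  have h1 := (tendsto_total_div_walks (fun m s => h.visits_over_walks m s j) ℓ).const_mul
    (1 / (Fintype.card V * ℓ : ℝ))
  have hlim : 1 / (Fintype.card V * ℓ : ℝ) * ∑ m, ∑ s ∈ range ℓ, (W ^ s) m j
      = cesaroUnigram W ℓ j := by
    rw [cesaroUnigram, ← mul_sum, sum_comm]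
    ring
  rw [hlim] at h1
  refine h1.congr fun r => ?_
  rw [unigram]
  ring

lemma negCountAt_length [Nonempty V] (h : IsTypical W π k x z) {r v : ℕ} (hr : 1 ≤ r)
    (hv : 1 ≤ v) (i j : V) :
    Tendsto (fun ℓ : ℕ => negCountAt k x (z r ℓ) i j r ℓ v / ℓ) atTop
      (𝓝 (k * (Fintype.card V * r * π i) * π j)) := by
  have h1 := tendsto_total_div_length (fun m p s => abs_indicator_le_one (x m p s = i))
    (fun m p => h.visits_along_walk m p i) r v
  have h2 := (h.neg_length r v i j hr hv).add ((h1.const_mul (k : ℝ)).mul (h.unigram_length hr j))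
  rw [zero_add] at h2
  refine h2.congr fun ℓ => ?_
  rw [negDeviation, sourceCountAt]
  ring

lemma negCountAt_walks (h : IsTypical W π k x z) {ℓ v : ℕ} (hℓ : 1 ≤ ℓ)
    (hv : 1 ≤ v) (i j : V) :
    Tendsto (fun r : ℕ => negCountAt k x (z r ℓ) i j r ℓ v / r) atTop
      (𝓝 (k * (∑ m, ∑ s ∈ range (ℓ - v), (W ^ s) m i) * cesaroUnigram W ℓ j)) := by
  have h1 := tendsto_total_div_walks (fun m s => h.visits_over_walks m s i) (ℓ - v)
  have h2 := (h.neg_walks ℓ v i j hℓ hv).add ((h1.const_mul (k : ℝ)).mul (h.unigram_walks ℓ j))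
  rw [zero_add] at h2
  refine h2.congr fun r => ?_
  rw [negDeviation, sourceCountAt]
  ring

lemma posCount_length [Nonempty V] (h : IsTypical W π k x z) (hα : Summable fun v => |α v|)
    {r : ℕ} (hr : 1 ≤ r) (i j : V) :
    Tendsto (fun ℓ : ℕ => 1 / ((r : ℝ) * Fintype.card V) * (posCount α x i j r ℓ / ℓ))
      atTop (𝓝 (posLimit W π α i j)) := by
  have hn : (Fintype.card V : ℝ) ≠ 0 := by simp
  have hr' : (r : ℝ) ≠ 0 := by positivity
  have h1 := tendsto_weighted_tsum hα (C := 1)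
    (c := fun (ℓ : ℕ) (v : ℕ+) => 1 / ((r : ℝ) * Fintype.card V * ℓ) * posCountAt x i j r ℓ v)
    (L := fun v => π i * (W ^ (v : ℕ)) i j)
    (fun ℓ v => abs_one_div_mul_le_one (by positivity) (abs_posCountAt_le x i j r ℓ v))
    fun v => by
      have h2 := (tendsto_total_div_length (V := V)
        (fun m p s => abs_indicator_le_one (x m p s = i ∧ x m p (s + v) = j))
        (fun m p => h.along_walk m p v i j) r v).const_mul (1 / (Fintype.card V * r : ℝ))
      rw [one_div_mul_eq_div, mul_div_cancel_left₀ _ (mul_ne_zero hn hr')] at h2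
      refine h2.congr fun ℓ => ?_
      rw [posCountAt]
      ring
  have hlim : ∑' v : ℕ+, α v * (π i * (W ^ (v : ℕ)) i j) = posLimit W π α i j := by
    rw [posLimit, ← tsum_mul_left]
    exact tsum_congr fun v => by ring
  rw [hlim] at h1
  refine h1.congr fun ℓ => ?_
  rw [posCount, ← tsum_div_const, ← tsum_mul_left]
  exact tsum_congr fun v => by ring

lemma negCount_length [Nonempty V] (h : IsTypical W π k x z) (hα : Summable fun v => |α v|)
    {r : ℕ} (hr : 1 ≤ r) (i j : V) :
    Tendsto (fun ℓ : ℕ => 1 / ((r : ℝ) * Fintype.card V) * (negCount α k x (z r ℓ) i j r ℓ / ℓ))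
      atTop (𝓝 (negLimit π α k i j)) := by
  have hn : (Fintype.card V : ℝ) ≠ 0 := by simp
  have hr' : (r : ℝ) ≠ 0 := by positivity
  have h1 := tendsto_weighted_tsum hα (C := k)
    (c := fun (ℓ : ℕ) (v : ℕ+) =>
      1 / ((r : ℝ) * Fintype.card V) * (negCountAt k x (z r ℓ) i j r ℓ v / ℓ))
    (L := fun v => k * π i * π j)
    (fun ℓ v => by
      rw [one_div_mul_eq_div, div_div, abs_div,
        abs_of_nonneg (by positivity : 0 ≤ (ℓ : ℝ) * (r * Fintype.card V))]
      refine div_le_of_le_mul₀ (by positivity) k.cast_nonneg ?_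
      exact (abs_negCountAt_le x (z r ℓ) i j r ℓ v).trans (le_of_eq (by ring)))
    fun v => by
      have h2 := (h.negCountAt_length hr v.pos i j).const_mul (1 / ((r : ℝ) * Fintype.card V))
      have hlim : 1 / ((r : ℝ) * Fintype.card V) * (k * (Fintype.card V * r * π i) * π j)
          = k * π i * π j := by field_simp
      rwa [hlim] at h2
  rw [tsum_mul_right, mul_comm (∑' v : ℕ+, α v)] at h1
  refine h1.congr fun ℓ => ?_
  rw [negCount, ← tsum_div_const, ← tsum_mul_left]
  exact tsum_congr fun v => by ring

lemma posCount_walks (h : IsTypical W π k x z) (hW : W ∈ Matrix.rowStochastic ℝ V)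
    (hα : Summable fun v => |α v|) (ℓ : ℕ) (i j : V) :
    Tendsto (fun r : ℕ => 1 / ((ℓ : ℝ) * Fintype.card V) * (posCount α x i j r ℓ / r))
      atTop (𝓝 (posLimitLen W α i j ℓ)) := by
  have h1 := tendsto_weighted_tsum hα (C := 1)
    (c := fun (r : ℕ) (v : ℕ+) => 1 / ((r : ℝ) * Fintype.card V * ℓ) * posCountAt x i j r ℓ v)
    (L := fun v => (W ^ (v : ℕ)) i j * sourceMean W i ℓ v)
    (fun r v => abs_one_div_mul_le_one (by positivity) (abs_posCountAt_le x i j r ℓ v))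
    fun v => by
      have h2 := (tendsto_total_div_walks
        (fun m s => h.over_walks m s v i j) (ℓ - v)).const_mul (1 / (ℓ * Fintype.card V : ℝ))
      have hlim : 1 / (ℓ * Fintype.card V : ℝ) *
          ∑ m, ∑ s ∈ range (ℓ - v), (W ^ s) m i * (W ^ (v : ℕ)) i j
          = (W ^ (v : ℕ)) i j * sourceMean W i ℓ v := by
        simp only [← sum_mul, sourceMean]
        ring
      rw [hlim] at h2
      refine h2.congr fun r => ?_
      rw [posCountAt]
      ring
  simp only [← mul_assoc] at h1
  rw [← posLimitLen_eq hW hα] at h1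
  refine h1.congr fun r => ?_
  rw [posCount, ← tsum_div_const, ← tsum_mul_left]
  exact tsum_congr fun v => by ring

lemma negCount_walks (h : IsTypical W π k x z) (hW : W ∈ Matrix.rowStochastic ℝ V)
    (hα : Summable fun v => |α v|) {ℓ : ℕ} (hℓ : 1 ≤ ℓ) (i j : V) :
    Tendsto (fun r : ℕ => 1 / ((ℓ : ℝ) * Fintype.card V) * (negCount α k x (z r ℓ) i j r ℓ / r))
      atTop (𝓝 (negLimitLen W α k i j ℓ)) := by
  have h1 := tendsto_weighted_tsum hα (C := k)
    (c := fun (r : ℕ) (v : ℕ+) =>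
      1 / ((ℓ : ℝ) * Fintype.card V) * (negCountAt k x (z r ℓ) i j r ℓ v / r))
    (L := fun v => k * cesaroUnigram W ℓ j * sourceMean W i ℓ v)
    (fun r v => by
      rw [one_div_mul_eq_div, div_div, abs_div,
        abs_of_nonneg (by positivity : 0 ≤ (r : ℝ) * (ℓ * Fintype.card V))]
      refine div_le_of_le_mul₀ (by positivity) k.cast_nonneg ?_
      exact (abs_negCountAt_le x (z r ℓ) i j r ℓ v).trans (le_of_eq (by ring)))
    fun v => by
      have h2 := (h.negCountAt_walks hℓ v.pos i j).const_mul (1 / ((ℓ : ℝ) * Fintype.card V))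
      refine h2.trans (le_of_eq (congrArg 𝓝 ?_))
      rw [sourceMean]
      ring
  have hlim : ∑' v : ℕ+, α v * (k * cesaroUnigram W ℓ j * sourceMean W i ℓ v)
      = negLimitLen W α k i j ℓ := by
    rw [negLimitLen_eq hW hα, ← tsum_mul_left]
    exact tsum_congr fun v => by ring
  rw [hlim] at h1
  refine h1.congr fun r => ?_
  rw [negCount, ← tsum_div_const, ← tsum_mul_left]
  exact tsum_congr fun v => by ring

end IsTypical

end Limits

lemma IsSampling.ae_isTypical {V Ω : Type*} [Fintype V] [DecidableEq V] [Nonempty V]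
    [MeasurableSpace V] [MeasurableSingletonClass V] [MeasurableSpace Ω] {P : Measure Ω}
    [IsProbabilityMeasure P] {W : Matrix V V ℝ} {π : V → ℝ} {k : ℕ} {X : V → ℕ → ℕ → Ω → V}
    {Z : ℕ → ℕ → V × ℕ × ℕ × ℕ × ℕ → Ω → V} (h : IsSampling P W k X Z)
    (hW : W ∈ Matrix.rowStochastic ℝ V) (huniq : ∀ ν, IsStationary W ν → ν = π) :
    ∀ᵐ ω ∂P, IsTypical W π k (fun m p s => X m p s ω) (fun r ℓ q => Z r ℓ q ω) := by
  have hdev := ae_all_iff.2 fun m => ae_all_iff.2 fun p =>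
    (h.markov m p).ae_avg_pairDeviation hW (h.measurable_walk m p)
  filter_upwards [hdev, h.ae_avg_walks hW, h.ae_negDeviation_length, h.ae_negDeviation_walks]
    with ω h1 h2 h3 h4
  exact ⟨fun m p v i j => tendsto_avg_pairs huniq (h1 m p) v i j, h2, h3, h4⟩

end VEC

theorem theorem2 {V Ω : Type*} [Fintype V] [DecidableEq V] [Nontrivial V]
    [MeasurableSpace V] [MeasurableSingletonClass V]
    [MeasurableSpace Ω] (P : Measure Ω) [IsProbabilityMeasure P]
    (G : VEC.WeightedGraph V) (hG : G.toSimpleGraph.Connected)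
    (π : V → ℝ) (hπ : VEC.IsStationary G.transition π)
    (α : ℕ+ → ℝ) (hα : Summable fun v => |α v|) (k : ℕ)
    (X : V → ℕ → ℕ → Ω → V) (Z : ℕ → ℕ → V × ℕ × ℕ × ℕ × ℕ → Ω → V)
    (hXZ : VEC.IsSampling P G.transition k X Z) :
    (∀ᵐ ω ∂P, ∀ i j : V,
      -- fixed number of walks, length tending to infinity
      (∀ r : ℕ, 1 ≤ r →
        Tendsto (fun ℓ : ℕ => 1 / ((r : ℝ) * Fintype.card V) * (VEC.nPos α X i j r ℓ ω / ℓ))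
          atTop (𝓝 (VEC.posLimit G.transition π α i j)) ∧
        Tendsto (fun ℓ : ℕ => 1 / ((r : ℝ) * Fintype.card V) * (VEC.nNeg α k X Z i j r ℓ ω / ℓ))
          atTop (𝓝 (VEC.negLimit π α k i j))) ∧
      -- fixed length, number of walks tending to infinity
      (∀ ℓ : ℕ, 1 ≤ ℓ →
        Tendsto (fun r : ℕ => 1 / ((ℓ : ℝ) * Fintype.card V) * (VEC.nPos α X i j r ℓ ω / r))
          atTop (𝓝 (VEC.posLimitLen G.transition α i j ℓ)) ∧
        Tendsto (fun r : ℕ => 1 / ((ℓ : ℝ) * Fintype.card V) * (VEC.nNeg α k X Z i j r ℓ ω / r))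
          atTop (𝓝 (VEC.negLimitLen G.transition α k i j ℓ))) ∧
      -- iterated limits, in both orders
      VEC.HasIteratedLimit
        (fun r ℓ => 1 / (Fintype.card V : ℝ) * (VEC.nPos α X i j r ℓ ω / (r * ℓ)))
        (VEC.posLimit G.transition π α i j) ∧
      VEC.HasIteratedLimit
        (fun ℓ r => 1 / (Fintype.card V : ℝ) * (VEC.nPos α X i j r ℓ ω / (r * ℓ)))
        (VEC.posLimit G.transition π α i j) ∧
      VEC.HasIteratedLimit
        (fun r ℓ => 1 / (Fintype.card V : ℝ) * (VEC.nNeg α k X Z i j r ℓ ω / (r * ℓ)))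
        (VEC.negLimit π α k i j) ∧
      VEC.HasIteratedLimit
        (fun ℓ r => 1 / (Fintype.card V : ℝ) * (VEC.nNeg α k X Z i j r ℓ ω / (r * ℓ)))
        (VEC.negLimit π α k i j)) ∧
    -- Cesàro convergence to the stationary distribution (no aperiodicity)
    (∀ μ ∈ stdSimplex ℝ V, ∀ j : V,
      Tendsto (fun ℓ : ℕ =>
        1 / (ℓ : ℝ) * ∑ s ∈ Finset.Icc 1 ℓ, Matrix.vecMul μ (G.transition ^ s) j)
        atTop (𝓝 (π j))) ∧
    (∀ j : V, Tendsto (fun ℓ : ℕ => VEC.cesaroUnigram G.transition ℓ j) atTop (𝓝 (π j))) := by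

  have hW := G.transition_mem_rowStochastic hG
  have huniq : ∀ ν, VEC.IsStationary G.transition ν → ν = π := fun ν hν =>
    G.stationary_unique hG hπ hν
  refine ⟨?_, fun μ hμ j => ?_, VEC.tendsto_cesaroUnigram hW huniq⟩
  · filter_upwards [hXZ.ae_isTypical hW huniq] with ω h i j
    have hpl := fun r hr => h.posCount_length hα (r := r) hr i j
    have hnl := fun r hr => h.negCount_length hα (r := r) hr i j
    have hpw := fun ℓ => h.posCount_walks hW hα ℓ i j
    have hnw := fun ℓ hℓ => h.negCount_walks hW hα (ℓ := ℓ) hℓ i j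
    refine ⟨fun r hr => ⟨hpl r hr, hnl r hr⟩, fun ℓ hℓ => ⟨hpw ℓ, hnw ℓ hℓ⟩,
      ⟨fun _ => VEC.posLimit G.transition π α i j, fun r hr => (hpl r hr).congr fun ℓ => ?_,
        tendsto_const_nhds⟩,
      ⟨VEC.posLimitLen G.transition α i j, fun ℓ _ => (hpw ℓ).congr fun r => ?_,
        VEC.tendsto_posLimitLen hW huniq hα i j⟩,
      ⟨fun _ => VEC.negLimit π α k i j, fun r hr => (hnl r hr).congr fun ℓ => ?_,
        tendsto_const_nhds⟩,
      ⟨VEC.negLimitLen G.transition α k i j, fun ℓ hℓ => (hnw ℓ hℓ).congr fun r => ?_,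
        VEC.tendsto_negLimitLen hW huniq hα i j⟩⟩
    all_goals
      simp only [VEC.nPos, VEC.nNeg]
      ring
  · -- a sum over `1 ≤ s ≤ ℓ` started from `μ` is a sum over `s < ℓ` started from `μ W`
    refine (VEC.tendsto_avg_vecMul_pow hW huniq (VEC.vecMul_mem_stdSimplex hW hμ) j).congr
      fun ℓ => ?_
    simp only [Matrix.vecMul_vecMul, ← pow_succ']
    rw [one_div_mul_eq_div, range_eq_Ico,
      sum_Ico_add' (fun s => Matrix.vecMul μ (G.transition ^ s) j) 0 ℓ 1]
    rfl
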